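/- Let $\mathbf T=(\mathbb R\cup\{-\infty\},\max,+)$ be the tropical semifield and let $\mathbf T[X_1^{\pm},\dots,X_n^{\pm}]$ be the tropical Laurent polynomial semiring in $n$ variables. For a congruence $C$ on it, let $$\mathbf V(C)=\{x\in\mathbb R^n : f(x)=g(x)\text{ for all }(f,g)\in C\}$$ be its congruence variety, and let $C_{\mathbf B}$ be the congruence on $\mathbf T[X_1^{\pm},\dots,X_n^{\pm}]$ generated by $\{(f_{\mathbf B},g_{\mathbf B}) : (f,g)\in C\}$, where $f_{\mathbf B}$ is obtained from $f$ by replacing every coefficient different from $-\infty$ by the real number $0$. A congruence $E$ on a commutative semiring is prime if it is proper and, for all pairs $\alpha,\beta$, $(\alpha_1\beta_1+\alpha_2\beta_2,\ \alpha_1\beta_2+\alpha_2\beta_1)\in E$ implies $\alpha\in E$ or $\beta\in E$. The Krull dimension $\dim A$ of an additively idempotent commutative semiring $A$ is the maximal number of strict inclusions in a chain of prime congruences on $A$. A polyhedral set is the solution set in $\mathbb R^n$ of finitely many linear (not necessarily homogeneous) inequalities; the dimension of a nonempty one is the dimension of its affine hull, and the empty set has dimension $-\infty$. The dimension of a finite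 union of polyhedral sets is the maximum of their dimensions. Let $C$ be a finitely generated proper congruence on $\mathbf T[X_1^{\pm},\dots,X_n^{\pm}]$. Then $\mathbf V(C)$ and $\mathbf V(C_{\mathbf B})$ are finite unions of polyhedral sets, and $$\dim \mathbf T[X_1^{\pm},\dots,X_n^{\pm}]/C=\max\{\dim\mathbf V(C)+1,\ \dim\mathbf V(C_{\mathbf B})\},$$ where $\dim\mathbf V(C)+1=-\infty$ if $\mathbf V(C)=\varnothing$. -/

import Mathlib

noncomputable section

namespace TropicalKrull

/-! ### Congruences, prime congruences and Krull dimension of commutative semirings -/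

/-- A congruence is proper if it is not the whole of `A × A`. -/
def IsProper {A : Type*} [CommSemiring A] (E : RingCon A) : Prop :=
  E ≠ ⊤

/-- A congruence is finitely generated if it is the smallest congruence containing some finite
set of pairs. -/
def IsFG {A : Type*} [CommSemiring A] (E : RingCon A) : Prop :=
  ∃ T : Finset (A × A), E = ringConGen (fun a b => (a, b) ∈ T)

/-- A congruence `E` is prime if it is proper and, for all pairs `α`, `β`, whenever the twisted
product `(α₁ β₁ + α₂ β₂, α₁ β₂ + α₂ β₁)` lies in `E`, one of `α`, `β` lies in `E`. -/
def IsPrimeCongruence {A : Type*} [CommSemiring A] (E : RingCon A) : Prop :=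
  IsProper E ∧ ∀ α β : A × A,
    E (α.1 * β.1 + α.2 * β.2) (α.1 * β.2 + α.2 * β.1) → E α.1 α.2 ∨ E β.1 β.2

/-- The Krull dimension of an (additively idempotent) commutative semiring: the supremum of the
number of strict inclusions in finite chains of prime congruences (`⊥` if there is no prime
congruence). -/
def krullDim (A : Type*) [CommSemiring A] : WithBot ℕ∞ :=
  Order.krullDim {E : RingCon A // IsPrimeCongruence E}

/-! ### Tropical Laurent polynomials -/

/-- The tropical semifield `(ℝ ∪ {-∞}, max, +)`. Mathlib's `Tropical R` is the min-plus algebra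
of `R`; applied to the order dual of `ℝ` with a top element added, it is the max-plus algebra.
In this commutative semiring `0` is `-∞`, `1` is the real number zero, `+` is the maximum and
`*` is the usual sum. -/
abbrev TropSemifield : Type :=
  Tropical (WithTop ℝᵒᵈ)

/-- A real number regarded as an element of the tropical semifield. -/
def ofReal (r : ℝ) : TropSemifield :=
  Tropical.trop ((OrderDual.toDual r : ℝᵒᵈ) : WithTop ℝᵒᵈ)

/-- The tropical Laurent polynomial semiring in `n` variables: finitely supported families of
coefficients indexed by the exponent vectors in `ℤⁿ`, with the convolution product. -/
abbrev Laurent (n : ℕ) : Type :=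
  AddMonoidAlgebra TropSemifield (Fin n → ℤ)

/-- The value of a tropical Laurent polynomial at `x ∈ ℝⁿ`: the tropical sum over its terms
of the tropical products `c ⊙ x₁^{⊙ m₁} ⊙ ⋯ ⊙ xₙ^{⊙ mₙ}`, that is, the maximum of
`c + m₁ x₁ + ⋯ + mₙ xₙ`. -/
def eval {n : ℕ} (x : Fin n → ℝ) (f : Laurent n) : TropSemifield :=
  f.coeff.sum (fun m c => c * ofReal (∑ i, (m i : ℝ) * x i))

open Classical in
/-- `f_𝐁`: every coefficient of `f` different from `-∞` is replaced by the real number zero. -/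
def boole {n : ℕ} (f : Laurent n) : Laurent n :=
  AddMonoidAlgebra.ofCoeff
    (f.coeff.mapRange (fun c : TropSemifield => if c = 0 then 0 else 1) (if_pos rfl))

/-- `C_𝐁`: the congruence generated by all pairs `(f_𝐁, g_𝐁)` with `(f, g) ∈ C`. -/
def booleCongruence {n : ℕ} (C : RingCon (Laurent n)) : RingCon (Laurent n) :=
  ringConGen (fun a b => ∃ f g : Laurent n, C f g ∧ a = boole f ∧ b = boole g)

/-- The congruence variety `V(C) ⊆ ℝⁿ`. -/
def variety {n : ℕ} (C : RingCon (Laurent n)) : Set (Fin n → ℝ) :=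
  {x | ∀ f g : Laurent n, C f g → eval x f = eval x g}

/-! ### Dimension of finite unions of polyhedral sets -/

/-- A polyhedral set in `ℝⁿ`: the solution set of finitely many linear inequalities. -/
def IsPolyhedral {n : ℕ} (P : Set (Fin n → ℝ)) : Prop :=
  ∃ (l : ℕ) (A : Matrix (Fin l) (Fin n) ℝ) (b : Fin l → ℝ), P = {x | b ≤ A.mulVec x}

open Classical in
/-- The dimension of the smallest affine subspace containing `P`, and `⊥` (that is, `-∞`) if `P`
is empty. -/
def affineDim {n : ℕ} (P : Set (Fin n → ℝ)) : WithBot ℕ∞ :=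
  if P.Nonempty then
    (((Module.finrank ℝ (affineSpan ℝ P).direction : ℕ) : ℕ∞) : WithBot ℕ∞)
  else ⊥

/-- `S` is the union of a finite family of polyhedral sets whose dimensions have maximum `d`
(`⊥` for the empty union). For a finite union `S` of polyhedral sets, the number `d` does not
depend on the family, and `d` is the dimension of `S`. -/
def HasPolyhedralDim {n : ℕ} (S : Set (Fin n → ℝ)) (d : WithBot ℕ∞) : Prop :=
  ∃ F : Finset (Set (Fin n → ℝ)),
    (∀ P ∈ F, IsPolyhedral P) ∧ S = ⋃ P ∈ F, P ∧ d = F.sup affineDim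

end TropicalKrull

end

set_option linter.unusedSectionVars false

/-! Modulo a prime congruence any two Laurent polynomials are comparable
(`IsPrimeCongruence.add_left_or_right`), so every nonzero polynomial is congruent to one of its
terms. The congruence is therefore determined by a total preorder on the group `ℝ × ℤⁿ` of
monomials, recorded by `cone`. Both varieties consist of preorders given by one real functional `u₀
r + ⟨m, x⟩`: `u₀ = 1` gives V(C), and `u₀ = 0`, which does not see coefficients, gives V(C_B).

Upper bound. A chain of r + 1 primes over C supplies monomials a₀, ..., a_{r-1} which, for the
smallest prime, are positive and each infinitely larger than its predecessors. By Fourier–Motzkin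
elimination (`exists_realForm_nonneg_iff`), finitely many of these relations, together with those
imposed by the generators of C, hold at a real point of one of the varieties. The a_i become affine
functions with arbitrarily large ratios on a single polyhedral piece; such functions are linearly
independent, so there are at most dim + 1 of them (`le_affineDim_add_one`). For `u₀ = 0` the variety
is a cone, the constant 1 can be added to the list, and the bound improves by one.

Lower bound. At a relative interior point x of a piece, the curve x + t w₀ + t² w₁ + ... stays in
the piece for small t > 0. Comparing monomials along it is lexicographic comparison under the
functionals x, w₀, w₁, ..., and dropping these from the end yields a chain of primes over C
(`le_krullDim_quotient`). Strictness needs monomials with integer exponents that separate the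
functionals; dual coordinates provide them, after moving x to rational coordinates when `u₀ = 0`. -/

noncomputable section

namespace TropicalKrull

open Tropical

/-! ### Max-plus semifields of ordered groups -/

section Semifield

variable {Γ : Type*} [AddCommGroup Γ] [LinearOrder Γ] [IsOrderedAddMonoid Γ]

/-- An element of an ordered group regarded as an element of its max-plus semifield. -/
def ofGroup (a : Γ) : Tropical (WithTop Γᵒᵈ) :=
  trop ((OrderDual.toDual a : Γᵒᵈ) : WithTop Γᵒᵈ)

theorem eq_zero_or_eq_ofGroup (c : Tropical (WithTop Γᵒᵈ)) : c = 0 ∨ ∃ a, c = ofGroup a := by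
  induction c using Tropical.tropRec with
  | _ X =>
    induction X using WithTop.recTopCoe with
    | top => exact Or.inl rfl
    | coe a => exact Or.inr ⟨OrderDual.ofDual a, rfl⟩

theorem ofGroup_ne_zero (a : Γ) : ofGroup a ≠ 0 := by
  intro h
  exact WithTop.coe_ne_top (congrArg untrop h)

/-- The order on `Tropical` follows the min convention, so it is opposite to that of `Γ`. -/
theorem ofGroup_le_ofGroup {a b : Γ} : ofGroup a ≤ ofGroup b ↔ b ≤ a := by
  rw [← untrop_le_iff]
  exact WithTop.coe_le_coe

theorem ofGroup_injective : Function.Injective (ofGroup : Γ → Tropical (WithTop Γᵒᵈ)) :=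
  fun _ _ h => le_antisymm (ofGroup_le_ofGroup.1 h.ge) (ofGroup_le_ofGroup.1 h.le)

theorem ofGroup_zero : ofGroup (0 : Γ) = 1 := rfl

theorem ofGroup_add (a b : Γ) : ofGroup (a + b) = ofGroup a * ofGroup b := rfl

theorem ofGroup_add_ofGroup (a b : Γ) : ofGroup a + ofGroup b = ofGroup (max a b) := by
  rcases le_total a b with h | h
  · rw [max_eq_right h, Tropical.add_eq_right (ofGroup_le_ofGroup.2 h)]
  · rw [max_eq_left h, Tropical.add_eq_left (ofGroup_le_ofGroup.2 h)]

theorem sum_ofGroup_le_sum_ofGroup {ι κ : Type*} (s : Finset ι) (t : Finset κ) (y : ι → Γ)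
    (z : κ → Γ) :
    ∑ k ∈ t, ofGroup (z k) ≤ ∑ i ∈ s, ofGroup (y i) ↔ ∀ i ∈ s, ∃ k ∈ t, y i ≤ z k := by
  rw [← untrop_le_iff, Finset.untrop_sum', Finset.untrop_sum', Finset.le_inf_iff]
  refine forall₂_congr fun i _ => ?_
  rw [Finset.inf_le_iff (WithTop.coe_lt_top _)]
  exact exists_congr fun k => and_congr_right fun _ => WithTop.coe_le_coe

/-- If a ≠ b and c ≠ d, a single one of the four products is strictly larger than both products on
the other side. This is what makes kernels of maps to such semifields prime. -/
theorem eq_or_eq_of_twisted (a b c d : Tropical (WithTop Γᵒᵈ))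
    (h : a * c + b * d = a * d + b * c) : a = b ∨ c = d := by
  have key : ∀ a b c d : Γ, max (a + c) (b + d) = max (a + d) (b + c) → a = b ∨ c = d := by
    intro a b c d h
    by_contra! hne
    rcases lt_or_gt_of_ne hne.1 with h1 | h1 <;> rcases lt_or_gt_of_ne hne.2 with h2 | h2
    · have := add_lt_add_of_lt_of_le h1 (le_refl d)
      have h3 := add_lt_add_of_le_of_lt (le_refl b) h2
      exact absurd h (ne_of_gt (lt_of_lt_of_le (max_lt this h3) (le_max_right _ _)))
    · have := add_lt_add_of_lt_of_le h1 (le_refl c)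
      have h3 := add_lt_add_of_le_of_lt (le_refl b) h2
      exact absurd h (ne_of_lt (lt_of_lt_of_le (max_lt this h3) (le_max_right _ _)))
    · have := add_lt_add_of_lt_of_le h1 (le_refl d)
      have h3 := add_lt_add_of_le_of_lt (le_refl a) h2
      exact absurd h (ne_of_lt (lt_of_lt_of_le (max_lt h3 this) (le_max_left _ _)))
    · have := add_lt_add_of_lt_of_le h1 (le_refl c)
      have h3 := add_lt_add_of_le_of_lt (le_refl a) h2
      exact absurd h (ne_of_gt (lt_of_lt_of_le (max_lt h3 this) (le_max_left _ _)))
  rcases eq_zero_or_eq_ofGroup a with rfl | ⟨a, rfl⟩ <;>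
  rcases eq_zero_or_eq_ofGroup b with rfl | ⟨b, rfl⟩ <;>
  rcases eq_zero_or_eq_ofGroup c with rfl | ⟨c, rfl⟩ <;>
  rcases eq_zero_or_eq_ofGroup d with rfl | ⟨d, rfl⟩ <;>
  simp only [mul_zero, zero_mul, add_zero, zero_add, ← ofGroup_add, ofGroup_add_ofGroup,
    ofGroup_injective.eq_iff, (ofGroup_ne_zero _).symm, or_true, true_or,
    add_right_inj, add_left_inj, eq_comm, or_self, or_false, false_or] at h ⊢
  all_goals first | exact h | exact h.symm | skip
  exact key a b c d (by simpa only [eq_comm] using h)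

theorem isPrimeCongruence_ker {A : Type*} [CommSemiring A] (φ : A →+* Tropical (WithTop Γᵒᵈ)) :
    IsPrimeCongruence (RingCon.ker φ) := by
  refine ⟨fun h => ?_, fun α β h => ?_⟩
  · have : RingCon.ker φ 0 1 := by rw [h]; trivial
    rw [RingCon.ker_apply, map_zero, map_one, ← ofGroup_zero] at this
    exact ofGroup_ne_zero _ this.symm
  · simp only [RingCon.ker_apply, map_add, map_mul] at h ⊢
    exact eq_or_eq_of_twisted _ _ _ _ h

/-- The homomorphism of semifields induced by a monotone homomorphism of ordered groups. -/
def coeffHom (φ : ℝ →+ Γ) (hφ : Monotone φ) : TropSemifield →+* Tropical (WithTop Γᵒᵈ) where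
  toFun c := trop ((untrop c).map fun r => OrderDual.toDual (φ (OrderDual.ofDual r)))
  map_zero' := rfl
  map_one' := congrArg ofGroup (map_zero φ)
  map_add' a b := by
    have hm : Monotone fun r : ℝᵒᵈ => OrderDual.toDual (φ (OrderDual.ofDual r)) :=
      fun x y h => hφ h
    exact congrArg trop (hm.withTop_map.map_min)
  map_mul' a b := by
    rcases eq_zero_or_eq_ofGroup a with rfl | ⟨a, rfl⟩
    · rw [zero_mul]; exact (zero_mul _).symm
    rcases eq_zero_or_eq_ofGroup b with rfl | ⟨b, rfl⟩
    · rw [mul_zero]; exact (mul_zero _).symm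
    exact congrArg ofGroup (map_add φ a b)

theorem coeffHom_ofGroup (φ : ℝ →+ Γ) (hφ : Monotone φ) (r : ℝ) :
    coeffHom φ hφ (ofGroup r) = ofGroup (φ r) := rfl

end Semifield

theorem ofReal_eq_ofGroup (r : ℝ) : ofReal r = ofGroup r := rfl

/-- The real number represented by a finite element of the tropical semifield. -/
def toReal (c : TropSemifield) : ℝ :=
  WithTop.recTopCoe 0 (fun r => OrderDual.ofDual r) (untrop c)

theorem toReal_ofGroup (r : ℝ) : toReal (ofGroup r) = r := rfl

theorem ofGroup_toReal {c : TropSemifield} (hc : c ≠ 0) : ofGroup (toReal c) = c := by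
  obtain ⟨r, rfl⟩ := (eq_zero_or_eq_ofGroup c).resolve_left hc
  rfl

/-! ### Evaluations in ordered groups -/

section Evaluation

variable {n : ℕ} {Γ : Type*} [AddCommGroup Γ] [LinearOrder Γ] [IsOrderedAddMonoid Γ]

theorem monotone_comp_inl (L : ℝ × (Fin n → ℤ) →+ Γ) (hL : ∀ r, 0 ≤ r → 0 ≤ L (r, 0)) :
    Monotone (L.comp (AddMonoidHom.inl ℝ (Fin n → ℤ))) := by
  intro r s h
  have := hL (s - r) (sub_nonneg.2 h)
  rw [← sub_nonneg, ← map_sub]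
  exact this

/-- Evaluation of Laurent polynomials along an order-compatible homomorphism from the group of
monomials to an ordered group. -/
def evalHom (L : ℝ × (Fin n → ℤ) →+ Γ) (hL : ∀ r, 0 ≤ r → 0 ≤ L (r, 0)) :
    Laurent n →+* Tropical (WithTop Γᵒᵈ) :=
  AddMonoidAlgebra.liftNCRingHom
    (coeffHom (L.comp (AddMonoidHom.inl ℝ (Fin n → ℤ))) (monotone_comp_inl L hL))
    { toFun := fun m => ofGroup (L (0, m.toAdd))
      map_one' := congrArg ofGroup (map_zero L)
      map_mul' := fun a b => by
        rw [← ofGroup_add, ← map_add, Prod.mk_add_mk, add_zero, toAdd_mul] }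
    (fun _ _ => Commute.all _ _)

/-- The exponent data (coefficient and exponent vector) of the term of `f` at `m`. -/
def term (f : Laurent n) (m : Fin n → ℤ) : ℝ × (Fin n → ℤ) :=
  (toReal (f.coeff m), m)

/-- The Laurent monomial with given coefficient and exponent vector. -/
def monomial (a : ℝ × (Fin n → ℤ)) : Laurent n :=
  AddMonoidAlgebra.single a.2 (ofGroup a.1)

theorem evalHom_monomial (L : ℝ × (Fin n → ℤ) →+ Γ) (hL : ∀ r, 0 ≤ r → 0 ≤ L (r, 0))
    (a : ℝ × (Fin n → ℤ)) : evalHom L hL (monomial a) = ofGroup (L a) := by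
  rw [evalHom, monomial, AddMonoidAlgebra.liftNCRingHom_single, coeffHom_ofGroup]
  change ofGroup (L (a.1, 0)) * ofGroup (L (0, a.2)) = _
  rw [← ofGroup_add, ← map_add, Prod.mk_add_mk, add_zero, zero_add]

theorem sum_monomial_term (f : Laurent n) : ∑ m ∈ f.coeff.support, monomial (term f m) = f := by
  conv_rhs => rw [← AddMonoidAlgebra.sum_coeff_single f]
  refine Finset.sum_congr rfl fun m hm => ?_
  rw [monomial, term, ofGroup_toReal (Finsupp.mem_support_iff.1 hm)]

theorem evalHom_apply (L : ℝ × (Fin n → ℤ) →+ Γ) (hL : ∀ r, 0 ≤ r → 0 ≤ L (r, 0))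
    (f : Laurent n) :
    evalHom L hL f = ∑ m ∈ f.coeff.support, ofGroup (L (term f m)) := by
  conv_lhs => rw [← sum_monomial_term f, map_sum]
  exact Finset.sum_congr rfl fun m _ => evalHom_monomial L hL _

/-- Every term of `f` is dominated by a term of `g`, as measured by `L`. -/
def Dominated (L : ℝ × (Fin n → ℤ) → Γ) (f g : Laurent n) : Prop :=
  ∀ m ∈ f.coeff.support, ∃ m' ∈ g.coeff.support, L (term f m) ≤ L (term g m')

theorem ker_evalHom_iff (L : ℝ × (Fin n → ℤ) →+ Γ) (hL : ∀ r, 0 ≤ r → 0 ≤ L (r, 0))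
    (f g : Laurent n) :
    RingCon.ker (evalHom L hL) f g ↔ Dominated L f g ∧ Dominated L g f := by
  rw [RingCon.ker_apply, le_antisymm_iff, evalHom_apply, evalHom_apply,
    sum_ofGroup_le_sum_ofGroup, sum_ofGroup_le_sum_ofGroup, and_comm]
  rfl

/-- The real functional `(r, m) ↦ u₀ r + ⟨m, u⟩` on the group of monomials. -/
def realForm (u : ℝ × (Fin n → ℝ)) : ℝ × (Fin n → ℤ) →+ ℝ where
  toFun a := u.1 * a.1 + ∑ i, (a.2 i : ℝ) * u.2 i
  map_zero' := by simp
  map_add' a b := by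
    simp only [Prod.fst_add, Prod.snd_add, Pi.add_apply, Int.cast_add, add_mul, mul_add,
      Finset.sum_add_distrib]
    ring

theorem realForm_apply (u : ℝ × (Fin n → ℝ)) (a : ℝ × (Fin n → ℤ)) :
    realForm u a = u.1 * a.1 + ∑ i, (a.2 i : ℝ) * u.2 i := rfl

theorem realForm_nonneg (u : ℝ × (Fin n → ℝ)) (hu : 0 ≤ u.1) (r : ℝ) (hr : 0 ≤ r) :
    0 ≤ realForm u (r, 0) := by
  simpa [realForm_apply] using mul_nonneg hu hr

theorem eval_eq_evalHom (x : Fin n → ℝ) (f : Laurent n) :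
    eval x f = evalHom (realForm (1, x)) (realForm_nonneg _ zero_le_one) f := by
  rw [evalHom_apply]
  refine Finset.sum_congr rfl fun m hm => ?_
  beta_reduce
  rw [← ofGroup_toReal (Finsupp.mem_support_iff.1 hm), ofReal_eq_ofGroup, ← ofGroup_add,
    realForm_apply, one_mul]
  rfl

theorem support_boole (f : Laurent n) : (boole f).coeff.support = f.coeff.support := by
  ext m
  classical
  simp only [Finsupp.mem_support_iff, boole, AddMonoidAlgebra.coeff_ofCoeff,
    Finsupp.mapRange_apply]
  by_cases h : f.coeff m = 0
  · simp [h]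
  · simp [h]

/-- Replacing the finite coefficients by 0 amounts to evaluating with a functional that vanishes on
them. -/
theorem eval_boole_eq_evalHom (x : Fin n → ℝ) (f : Laurent n) :
    eval x (boole f) = evalHom (realForm (0, x)) (realForm_nonneg _ le_rfl) f := by
  rw [eval_eq_evalHom, evalHom_apply, evalHom_apply, support_boole]
  refine Finset.sum_congr rfl fun m hm => ?_
  have : (boole f).coeff m = ofGroup 0 := by
    rw [boole, AddMonoidAlgebra.coeff_ofCoeff, Finsupp.mapRange_apply,
      if_neg (Finsupp.mem_support_iff.1 hm)]
    rfl
  rw [realForm_apply, realForm_apply, term, this]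
  simp [toReal_ofGroup, term]

/-- The points of `ℝⁿ` at which the functional with leading coefficient `ε` identifies the two
sides of every pair in `C`. -/
def formVariety (ε : ℝ) (C : RingCon (Laurent n)) : Set (Fin n → ℝ) :=
  {x | ∀ f g : Laurent n, C f g → Dominated (realForm (ε, x)) f g}

theorem mem_formVariety_iff {ε : ℝ} (hε : 0 ≤ ε) {C : RingCon (Laurent n)} {x : Fin n → ℝ} :
    x ∈ formVariety ε C ↔ C ≤ RingCon.ker (evalHom (realForm (ε, x)) (realForm_nonneg _ hε)) := by
  constructor
  · intro h f g hfg
    exact (ker_evalHom_iff _ _ _ _).2 ⟨h f g hfg, h g f (C.symm hfg)⟩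
  · intro h f g hfg
    exact ((ker_evalHom_iff _ _ _ _).1 (h hfg)).1

theorem variety_eq_formVariety (C : RingCon (Laurent n)) : variety C = formVariety 1 C := by
  ext x
  rw [mem_formVariety_iff zero_le_one]
  simp only [variety, Set.mem_ofPred_eq, eval_eq_evalHom, RingCon.le_def, RingCon.ker_apply]

theorem variety_booleCongruence (C : RingCon (Laurent n)) :
    variety (booleCongruence C) = formVariety 0 C := by
  ext x
  rw [variety_eq_formVariety, mem_formVariety_iff zero_le_one, mem_formVariety_iff le_rfl,
    booleCongruence, RingCon.ringConGen_le]
  constructor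
  · intro h f g hfg
    have := h _ _ ⟨f, g, hfg, rfl, rfl⟩
    rwa [RingCon.ker_apply, ← eval_eq_evalHom, ← eval_eq_evalHom, eval_boole_eq_evalHom,
      eval_boole_eq_evalHom] at this
  · rintro h _ _ ⟨f, g, hfg, rfl, rfl⟩
    rw [RingCon.ker_apply, ← eval_eq_evalHom, ← eval_eq_evalHom, eval_boole_eq_evalHom,
      eval_boole_eq_evalHom]
    exact h hfg

/-- A kernel is a congruence, so only generators need checking; for finitely many generators this
leaves finitely many conditions on x. -/
theorem mem_formVariety_ringConGen {ε : ℝ} (hε : 0 ≤ ε) (T : Set (Laurent n × Laurent n))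
    {x : Fin n → ℝ} :
    x ∈ formVariety ε (ringConGen fun a b => (a, b) ∈ T) ↔
      ∀ p ∈ T, Dominated (realForm (ε, x)) p.1 p.2 ∧ Dominated (realForm (ε, x)) p.2 p.1 := by
  rw [mem_formVariety_iff hε, RingCon.ringConGen_le]
  constructor
  · intro h p hp
    exact (ker_evalHom_iff _ _ _ _).1 (h p.1 p.2 hp)
  · intro h f g hfg
    exact (ker_evalHom_iff _ _ _ _).2 (h (f, g) hfg)

end Evaluation

/-! ### Realizing the signs of finitely many monomials -/

/-- If k • a and -a lie in N, adding k - 1 copies of -a to k • a recovers a. -/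
theorem zsmul_mem_iff_of_total {M : Type*} [AddCommGroup M] (N : AddSubmonoid M)
    (htot : ∀ a, a ∈ N ∨ -a ∈ N) {k : ℤ} (hk : 0 < k) (a : M) : k • a ∈ N ↔ a ∈ N := by
  obtain ⟨j, rfl⟩ : ∃ j : ℕ, k = j + 1 := ⟨(k - 1).toNat, by omega⟩
  have hj : ((j : ℤ) + 1) • a = j • a + a := by rw [add_smul, one_smul, natCast_zsmul]
  rw [hj]
  refine ⟨fun h => ?_, fun h => N.add_mem (N.nsmul_mem h j) h⟩
  rcases htot a with h1 | h1
  · exact h1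
  · have := N.add_mem h (N.nsmul_mem h1 j)
    rwa [smul_neg, add_comm, neg_add_cancel_left] at this

/-- The homomorphism forgetting the exponent of the first variable. -/
def dropFirst (n : ℕ) : ℝ × (Fin (n + 1) → ℤ) →+ ℝ × (Fin n → ℤ) where
  toFun a := (a.1, fun i => a.2 i.succ)
  map_zero' := rfl
  map_add' _ _ := rfl

/-- The homomorphism inserting a first variable with exponent zero. -/
def consZero (n : ℕ) : ℝ × (Fin n → ℤ) →+ ℝ × (Fin (n + 1) → ℤ) where
  toFun a := (a.1, Fin.cons 0 a.2)
  map_zero' := by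
    refine Prod.ext rfl (funext fun i => ?_)
    refine Fin.cases rfl (fun _ => rfl) i
  map_add' a b := by
    refine Prod.ext rfl (funext fun i => ?_)
    refine Fin.cases ?_ (fun _ => rfl) i
    simp

theorem consZero_dropFirst {n : ℕ} (a : ℝ × (Fin (n + 1) → ℤ)) (ha : a.2 0 = 0) :
    consZero n (dropFirst n a) = a := by
  refine Prod.ext rfl (funext fun i => ?_)
  exact Fin.cases ha.symm (fun _ => rfl) i

theorem realForm_cons {n : ℕ} (ε x₀ : ℝ) (x : Fin n → ℝ) (a : ℝ × (Fin (n + 1) → ℤ)) :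
    realForm (ε, Fin.cons x₀ x) a = a.2 0 * x₀ + realForm (ε, x) (dropFirst n a) := by
  simp only [realForm_apply, Fin.sum_univ_succ, Fin.cons_zero, Fin.cons_succ, dropFirst,
    AddMonoidHom.coe_mk, ZeroHom.coe_mk]
  ring

/-- Fourier–Motzkin elimination: finitely many monomials have, at a suitable real point, the signs
prescribed by a total preorder on the group of monomials. -/
theorem exists_realForm_nonneg_iff {n : ℕ} (N : AddSubmonoid (ℝ × (Fin n → ℤ)))
    (htot : ∀ a, a ∈ N ∨ -a ∈ N) (hpos : ∀ r : ℝ, 0 ≤ r → (r, 0) ∈ N) {ε : ℝ}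
    (hε : (ε = 1 ∧ ∀ r : ℝ, r < 0 → (r, 0) ∉ N) ∨ (ε = 0 ∧ ∃ r : ℝ, r < 0 ∧ (r, 0) ∈ N))
    (S : Finset (ℝ × (Fin n → ℤ))) :
    ∃ x : Fin n → ℝ, ∀ a ∈ S, a ∈ N ↔ 0 ≤ realForm (ε, x) a := by
  classical
  induction n with
  | zero =>
    refine ⟨0, fun a _ => ?_⟩
    obtain ⟨r, m⟩ := a
    obtain rfl : m = 0 := Subsingleton.elim _ _
    rcases hε with ⟨rfl, h⟩ | ⟨rfl, s, hs, hsN⟩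
    · simp only [realForm_apply, one_mul, Finset.univ_eq_empty, Finset.sum_empty, add_zero]
      exact ⟨fun hr => not_lt.1 fun h0 => h r h0 hr, hpos r⟩
    · simp only [realForm_apply, zero_mul, Finset.univ_eq_empty, Finset.sum_empty, add_zero,
        le_refl, iff_true]
      -- With s < 0 in N, r = (r - k s) + k s is in N once k is large enough to make r - k s
      -- nonnegative.
      obtain ⟨k, hk⟩ := exists_nat_ge (r / s)
      have h1 : 0 ≤ r - k * s := by
        rw [div_le_iff_of_neg hs] at hk
        linarith
      have h2 := N.add_mem (hpos _ h1) (N.nsmul_mem hsN k)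
      have h3 : ((r - k * s, 0) : ℝ × (Fin 0 → ℤ)) + k • ((s, 0) : ℝ × (Fin 0 → ℤ)) = (r, 0) := by
        refine Prod.ext ?_ (Subsingleton.elim _ _)
        simp
      rwa [h3] at h2
  | succ n ih =>
    -- Adding negatives lets a monomial with negative first exponent be treated through its
    -- negative, which lies in `P`.
    set S' := S ∪ S.image (fun a => -a) with hS'
    set P := S'.filter (fun a => 0 < a.2 0) with hP
    -- The combination of p and q in which the first variable cancels.
    set D : (ℝ × (Fin (n + 1) → ℤ)) → (ℝ × (Fin (n + 1) → ℤ)) → (ℝ × (Fin (n + 1) → ℤ)) :=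
      fun p q => p.2 0 • q - q.2 0 • p with hDdef
    have hc : ∀ r : ℝ, consZero n (r, 0) = (r, 0) := by
      intro r
      refine Prod.ext rfl (funext fun i => ?_)
      exact Fin.cases rfl (fun _ => rfl) i
    obtain ⟨x, hx⟩ := ih (N.comap (consZero n))
      (fun a => by simpa only [AddSubmonoid.mem_comap, map_neg] using htot (consZero n a))
      (fun r hr => by simpa only [AddSubmonoid.mem_comap, hc] using hpos r hr)
      (by simpa only [AddSubmonoid.mem_comap, hc] using hε)
      ((S.filter fun a => a.2 0 = 0).image (dropFirst n) ∪
        (P ×ˢ P).image fun pq => dropFirst n (D pq.1 pq.2))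
    have hx0 : ∀ a ∈ S, a.2 0 = 0 → (a ∈ N ↔ 0 ≤ realForm (ε, x) (dropFirst n a)) := by
      intro a ha h0
      rw [← hx (dropFirst n a) (Finset.mem_union_left _ (Finset.mem_image_of_mem _
        (Finset.mem_filter.2 ⟨ha, h0⟩))), AddSubmonoid.mem_comap, consZero_dropFirst a h0]
    -- The value of the first coordinate at which the functional vanishes on p. On `D p q` the
    -- functional equals p₀ q₀ (θ p - θ q), where p₀, q₀ are the first exponents.
    set θ : (ℝ × (Fin (n + 1) → ℤ)) → ℝ :=
      fun p => -realForm (ε, x) (dropFirst n p) / p.2 0 with hθ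
    have hPpos : ∀ p ∈ P, 0 < p.2 0 := fun p hp => (Finset.mem_filter.1 hp).2
    have hD : ∀ p ∈ P, ∀ q ∈ P, (D p q ∈ N ↔ θ q ≤ θ p) := by
      intro p hp q hq
      have h0 : (D p q).2 0 = 0 := by
        simp only [hDdef, Prod.snd_sub, Prod.smul_snd, Pi.sub_apply, Pi.smul_apply, smul_eq_mul]
        ring
      have hp0 : (0 : ℝ) < p.2 0 := by exact_mod_cast hPpos p hp
      have hq0 : (0 : ℝ) < q.2 0 := by exact_mod_cast hPpos q hq
      have h1 := hx (dropFirst n (D p q)) (Finset.mem_union_right _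
        (Finset.mem_image.2 ⟨(p, q), Finset.mk_mem_product hp hq, rfl⟩))
      rw [AddSubmonoid.mem_comap, consZero_dropFirst _ h0] at h1
      rw [h1, hDdef, map_sub, map_zsmul, map_zsmul, map_sub, map_zsmul, map_zsmul,
        zsmul_eq_mul, zsmul_eq_mul, hθ, div_le_div_iff₀ hq0 hp0, sub_nonneg]
      constructor <;> intro h <;> linarith
    obtain ⟨x₀, hx₀⟩ : ∃ x₀ : ℝ, ∀ p ∈ P, (p ∈ N ↔ θ p ≤ x₀) ∧ (-p ∈ N ↔ x₀ ≤ θ p) := by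
      -- If some p in `P` is equivalent to 0, then x₀ is forced to be θ p. Otherwise x₀ only has to
      -- separate strictly the thresholds of the members of N from those of the nonmembers.
      by_cases hz : ∃ p ∈ P, p ∈ N ∧ -p ∈ N
      · obtain ⟨p, hp, hpN, hpN'⟩ := hz
        refine ⟨θ p, fun q hq => ⟨?_, ?_⟩⟩
        · rw [← hD p hp q hq, ← zsmul_mem_iff_of_total N htot (hPpos p hp) q]
          have h1 := (zsmul_mem_iff_of_total N htot (hPpos q hq) p).2 hpN
          have h2 := (zsmul_mem_iff_of_total N htot (hPpos q hq) (-p)).2 hpN'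
          constructor
          · intro h
            have := N.add_mem h h2
            rwa [smul_neg, ← sub_eq_add_neg] at this
          · intro h
            have := N.add_mem h h1
            rwa [hDdef, sub_add_cancel] at this
        · rw [← hD q hq p hp, ← zsmul_mem_iff_of_total N htot (hPpos p hp) (-q)]
          have h1 := (zsmul_mem_iff_of_total N htot (hPpos q hq) p).2 hpN
          have h2 := (zsmul_mem_iff_of_total N htot (hPpos q hq) (-p)).2 hpN'
          constructor
          · intro h
            have := N.add_mem h1 h
            rwa [smul_neg, ← sub_eq_add_neg] at this
          · intro h
            have := N.add_mem h h2
            rwa [hDdef, smul_neg, ← sub_eq_add_neg, sub_right_comm, sub_self, zero_sub,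
              ← smul_neg] at this
      · push Not at hz
        obtain ⟨x₀, h1, h2⟩ := Order.exists_between_finsets
          ((P.filter (· ∈ N)).image θ) ((P.filter (· ∉ N)).image θ) (by
            intro s hs t ht
            obtain ⟨p, hp, rfl⟩ := Finset.mem_image.1 hs
            obtain ⟨q, hq, rfl⟩ := Finset.mem_image.1 ht
            rw [Finset.mem_filter] at hp hq
            rw [← not_le, ← hD p hp.1 q hq.1]
            intro h
            have h1 := (zsmul_mem_iff_of_total N htot (hPpos q hq.1) p).2 hp.2
            have := N.add_mem h h1
            rw [hDdef, sub_add_cancel, zsmul_mem_iff_of_total N htot (hPpos p hp.1)] at this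
            exact hq.2 this)
        refine ⟨x₀, fun p hp => ?_⟩
        by_cases hpN : p ∈ N
        · have := h1 _ (Finset.mem_image_of_mem _ (Finset.mem_filter.2 ⟨hp, hpN⟩))
          exact ⟨iff_of_true hpN this.le, iff_of_false (hz p hp hpN) (not_le.2 this)⟩
        · have := h2 _ (Finset.mem_image_of_mem _ (Finset.mem_filter.2 ⟨hp, hpN⟩))
          exact ⟨iff_of_false hpN (not_le.2 this),
            iff_of_true ((htot p).resolve_left hpN) this.le⟩
    refine ⟨Fin.cons x₀ x, fun a ha => ?_⟩
    rw [realForm_cons]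
    rcases lt_trichotomy (a.2 0) 0 with h | h | h
    · have hmem : -a ∈ P := Finset.mem_filter.2 ⟨Finset.mem_union_right _
        (Finset.mem_image_of_mem _ ha), by simpa using h⟩
      have h' : (0 : ℝ) < -(a.2 0 : ℝ) := by
        have : ((a.2 0 : ℤ) : ℝ) < 0 := by exact_mod_cast h
        linarith
      have := (hx₀ _ hmem).2
      rw [neg_neg] at this
      rw [this, hθ]
      simp only [map_neg, Prod.snd_neg, Pi.neg_apply, Int.cast_neg, neg_neg]
      rw [le_div_iff₀ h']
      constructor <;> intro h <;> linarith
    · rw [hx0 a ha h, h]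
      simp
    · have hmem : a ∈ P := Finset.mem_filter.2 ⟨Finset.mem_union_left _ ha, h⟩
      have h' : (0 : ℝ) < (a.2 0 : ℝ) := by exact_mod_cast h
      rw [(hx₀ _ hmem).1, hθ, div_le_iff₀ h']
      constructor <;> intro h <;> linarith

/-! ### The cone of a prime congruence -/

section Cone

variable {n : ℕ}

theorem laurent_add_self (f : Laurent n) : f + f = f := by
  refine AddMonoidAlgebra.ext (Finsupp.ext fun m => ?_)
  exact Tropical.add_self _

theorem monomial_add (a b : ℝ × (Fin n → ℤ)) : monomial (a + b) = monomial a * monomial b := by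
  simp only [monomial, AddMonoidAlgebra.single_mul_single, Prod.snd_add, Prod.fst_add, ofGroup_add]

theorem monomial_zero : monomial (0 : ℝ × (Fin n → ℤ)) = 1 := rfl

theorem monomial_mul_neg (a : ℝ × (Fin n → ℤ)) : monomial a * monomial (-a) = 1 := by
  rw [← monomial_add, add_neg_cancel, monomial_zero]

theorem add_monomial_term (f : Laurent n) {m : Fin n → ℤ} (hm : m ∈ f.coeff.support) :
    monomial (term f m) + f = f := by
  have h := (Finset.add_sum_erase _ (fun m => monomial (term f m)) hm).trans (sum_monomial_term f)
  calc monomial (term f m) + f = monomial (term f m) + (monomial (term f m) +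
        ∑ x ∈ f.coeff.support.erase m, monomial (term f x)) := by rw [h]
    _ = f := by rw [← add_assoc, laurent_add_self, h]

/-- By idempotency both components of the twisted product of (f + g, f) and (f + g, g) equal f² + fg
+ g². -/
theorem IsPrimeCongruence.add_left_or_right {E : RingCon (Laurent n)} (hE : IsPrimeCongruence E)
    (f g : Laurent n) : E (f + g) f ∨ E (f + g) g := by
  refine hE.2 (f + g, f) (f + g, g) ?_
  have h : (f + g) * (f + g) + f * g = (f + g) * g + f * (f + g) := by
    calc (f + g) * (f + g) + f * g = f * f + g * g + (f * g + f * g + f * g) := by ring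
      _ = f * f + g * g + (f * g + f * g) := by simp only [laurent_add_self (f * g)]
      _ = (f + g) * g + f * (f + g) := by ring
  simp only [h]
  exact E.refl _

theorem IsPrimeCongruence.not_zero_monomial {E : RingCon (Laurent n)} (hE : IsPrimeCongruence E)
    (a : ℝ × (Fin n → ℤ)) : ¬ E (monomial a) 0 := by
  intro h
  have h1 := E.mul h (E.refl (monomial (-a)))
  rw [monomial_mul_neg, zero_mul] at h1
  have h2 : ∀ f, E f 0 := fun f => by simpa using E.mul h1 (E.refl f)
  refine hE.1 (top_le_iff.1 fun f g _ => E.trans (h2 f) (E.symm (h2 g)))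

/-- The submonoid of the monomials that dominate `1` modulo a congruence. -/
def cone (E : RingCon (Laurent n)) : AddSubmonoid (ℝ × (Fin n → ℤ)) where
  carrier := {a | E (monomial a + 1) (monomial a)}
  zero_mem' := by
    change E (1 + 1) 1
    rw [laurent_add_self]
    exact E.refl 1
  add_mem' := by
    intro a b ha hb
    change E (monomial a + 1) (monomial a) at ha
    change E (monomial b + 1) (monomial b) at hb
    change E (monomial (a + b) + 1) (monomial (a + b))
    rw [monomial_add]
    have h1 := E.mul ha (E.refl (monomial b))
    rw [add_mul, one_mul] at h1
    have h2 := E.add (E.refl (monomial a * monomial b)) hb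
    rw [← add_assoc] at h2
    exact E.trans (E.trans (E.add (E.symm h1) (E.refl 1)) h2) h1

theorem mem_cone {E : RingCon (Laurent n)} {a : ℝ × (Fin n → ℤ)} :
    a ∈ cone E ↔ E (monomial a + 1) (monomial a) := Iff.rfl

theorem sub_mem_cone {E : RingCon (Laurent n)} {a b : ℝ × (Fin n → ℤ)} :
    a - b ∈ cone E ↔ E (monomial a + monomial b) (monomial a) := by
  have key : ∀ (c : ℝ × (Fin n → ℤ)) (f g : Laurent n), E f g → E (f * monomial c) (g * monomial c) :=
    fun c f g h => E.mul h (E.refl _)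
  rw [mem_cone]
  constructor
  · intro h
    have := key b _ _ h
    rwa [add_mul, one_mul, ← monomial_add, sub_add_cancel] at this
  · intro h
    have := key (-b) _ _ h
    rwa [add_mul, monomial_mul_neg, ← monomial_add, ← sub_eq_add_neg] at this

theorem cone_mono {E E' : RingCon (Laurent n)} (h : E ≤ E') : cone E ≤ cone E' :=
  fun _ ha => h ha

theorem IsPrimeCongruence.cone_total {E : RingCon (Laurent n)} (hE : IsPrimeCongruence E)
    (a : ℝ × (Fin n → ℤ)) : a ∈ cone E ∨ -a ∈ cone E := by
  rcases hE.add_left_or_right (monomial a) 1 with h | h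
  · exact Or.inl h
  · right
    rw [← zero_sub, sub_mem_cone, monomial_zero, add_comm]
    exact h

theorem real_mem_cone (E : RingCon (Laurent n)) {r : ℝ} (hr : 0 ≤ r) : (r, 0) ∈ cone E := by
  have : monomial ((r, 0) : ℝ × (Fin n → ℤ)) + 1 = monomial (r, 0) := by
    rw [← monomial_zero]
    change AddMonoidAlgebra.single 0 (ofGroup r) + AddMonoidAlgebra.single 0 (ofGroup 0) =
      AddMonoidAlgebra.single 0 (ofGroup r)
    rw [← AddMonoidAlgebra.single_add, ofGroup_add_ofGroup, max_eq_left hr]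
  rw [mem_cone, this]
  exact E.refl _

theorem IsPrimeCongruence.exists_rel_term {E : RingCon (Laurent n)} (hE : IsPrimeCongruence E)
    {f : Laurent n} (hf : f.coeff.support.Nonempty) :
    ∃ m ∈ f.coeff.support, E f (monomial (term f m)) := by
  have key : ∀ s : Finset (Fin n → ℤ), s.Nonempty →
      ∃ m ∈ s, E (∑ m ∈ s, monomial (term f m)) (monomial (term f m)) := by
    intro s hs
    induction hs using Finset.Nonempty.cons_induction with
    | singleton a => exact ⟨a, Finset.mem_singleton_self a, by
        rw [Finset.sum_singleton]; exact E.refl _⟩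
    | cons a s ha hs ih =>
      obtain ⟨m, hm, h⟩ := ih
      rw [Finset.sum_cons]
      have h1 := E.add (E.refl (monomial (term f a))) h
      rcases hE.add_left_or_right (monomial (term f a)) (monomial (term f m)) with h2 | h2
      · exact ⟨a, Finset.mem_cons_self a s, E.trans h1 h2⟩
      · exact ⟨m, Finset.mem_cons_of_mem hm, E.trans h1 h2⟩
  have := key _ hf
  rwa [sum_monomial_term] at this

theorem support_nonempty {f : Laurent n} (hf : f ≠ 0) : f.coeff.support.Nonempty := by
  rw [Finset.nonempty_iff_ne_empty, Ne, Finsupp.support_eq_empty]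
  exact fun h => hf (AddMonoidAlgebra.coeff_eq_zero.1 h)

theorem IsPrimeCongruence.eq_zero_of_rel_zero {E : RingCon (Laurent n)} (hE : IsPrimeCongruence E)
    {f : Laurent n} (h : E f 0) : f = 0 := by
  by_contra hf
  obtain ⟨m, -, hm⟩ := hE.exists_rel_term (support_nonempty hf)
  exact hE.not_zero_monomial _ (E.trans (E.symm hm) h)

/-- A term of f is absorbed by f, f is congruent to g, and g is congruent to one of its own terms.
-/
theorem IsPrimeCongruence.exists_sub_mem_cone {E : RingCon (Laurent n)} (hE : IsPrimeCongruence E)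
    {f g : Laurent n} (hfg : E f g) {m : Fin n → ℤ} (hm : m ∈ f.coeff.support) :
    ∃ m' ∈ g.coeff.support, term g m' - term f m ∈ cone E := by
  have hg : g ≠ 0 := by
    rintro rfl
    rw [hE.eq_zero_of_rel_zero hfg] at hm
    simp at hm
  obtain ⟨m', hm', h⟩ := hE.exists_rel_term (support_nonempty hg)
  refine ⟨m', hm', sub_mem_cone.2 ?_⟩
  have h1 := E.add (E.refl (monomial (term f m))) (E.trans hfg h)
  rw [add_monomial_term f hm] at h1
  rw [add_comm]
  exact E.trans (E.symm h1) (E.trans hfg h)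

/-- Since polynomials reduce to terms, a strict inclusion of primes is visible on monomials: some a
is equivalent to 1 for E' but strictly above 1 for E. -/
theorem exists_mem_cone_of_lt {E E' : RingCon (Laurent n)} (hE : IsPrimeCongruence E)
    (hE' : IsPrimeCongruence E') (h : E < E') :
    ∃ a, a ∈ cone E' ∧ -a ∈ cone E' ∧ -a ∉ cone E := by
  by_contra! hcon
  refine h.not_ge fun f g hfg => ?_
  by_cases hf : f = 0
  · subst hf
    rw [hE'.eq_zero_of_rel_zero (E'.symm hfg)]
    exact E.refl 0
  by_cases hg : g = 0
  · subst hg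
    exact absurd (hE'.eq_zero_of_rel_zero hfg) hf
  obtain ⟨m, -, hm⟩ := hE.exists_rel_term (support_nonempty hf)
  obtain ⟨m', -, hm'⟩ := hE.exists_rel_term (support_nonempty hg)
  set a := term f m
  set b := term g m'
  have hab : E' (monomial a) (monomial b) :=
    E'.trans (E'.symm (h.le hm)) (E'.trans hfg (h.le hm'))
  have h1 : a - b ∈ cone E' := by
    rw [sub_mem_cone]
    have := E'.add (E'.refl (monomial a)) (E'.symm hab)
    rwa [laurent_add_self] at this
  have h2 : b - a ∈ cone E' := by
    rw [sub_mem_cone]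
    have := E'.add (E'.refl (monomial b)) hab
    rwa [laurent_add_self] at this
  have h3 := hcon (a - b) h1 (by rwa [neg_sub])
  have h4 := hcon (b - a) h2 (by rwa [neg_sub])
  rw [neg_sub, sub_mem_cone] at h3 h4
  rw [add_comm] at h3
  exact E.trans hm (E.trans (E.trans (E.symm h4) h3) (E.symm hm'))

theorem IsPrimeCongruence.comap_mk' {C : RingCon (Laurent n)} {E : RingCon C.Quotient}
    (hE : IsPrimeCongruence E) : IsPrimeCongruence (E.comap C.mk') := by
  refine ⟨fun h => hE.1 (top_le_iff.1 fun x y _ => ?_), fun α β h => ?_⟩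
  · obtain ⟨f, rfl⟩ := RingCon.mk'_surjective C x
    obtain ⟨g, rfl⟩ := RingCon.mk'_surjective C y
    have : E.comap C.mk' f g := by rw [h]; trivial
    exact this
  · refine hE.2 (C.mk' α.1, C.mk' α.2) (C.mk' β.1, C.mk' β.2) ?_
    simp only [← map_mul, ← map_add]
    exact h

end Cone

open Filter

/-! ### Finite unions of polyhedral sets -/

section Polyhedral

variable {n : ℕ}

/-- `S` is a finite union of polyhedral sets. -/
def IsPolyhedralUnion (S : Set (Fin n → ℝ)) : Prop :=
  ∃ F : Finset (Set (Fin n → ℝ)), (∀ P ∈ F, IsPolyhedral P) ∧ S = ⋃ P ∈ F, P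

theorem isPolyhedral_univ : IsPolyhedral (Set.univ : Set (Fin n → ℝ)) :=
  ⟨0, 0, 0, (Set.eq_univ_of_forall fun _ i => i.elim0).symm⟩

theorem IsPolyhedral.inter {P Q : Set (Fin n → ℝ)} (hP : IsPolyhedral P) (hQ : IsPolyhedral Q) :
    IsPolyhedral (P ∩ Q) := by
  obtain ⟨k, A, b, rfl⟩ := hP
  obtain ⟨l, B, c, rfl⟩ := hQ
  refine ⟨k + l, Matrix.of (Fin.append (fun i j => A i j) (fun i j => B i j)), Fin.append b c, ?_⟩
  ext x
  have hl : ∀ i, (Matrix.of (Fin.append (fun i j => A i j) (fun i j => B i j))).mulVec x (Fin.castAdd l i) =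
      A.mulVec x i := fun i => by
    change dotProduct (Fin.append (fun i j => A i j) (fun i j => B i j) _) x = _
    rw [Fin.append_left]
    rfl
  have hr : ∀ i, (Matrix.of (Fin.append (fun i j => A i j) (fun i j => B i j))).mulVec x (Fin.natAdd k i) =
      B.mulVec x i := fun i => by
    change dotProduct (Fin.append (fun i j => A i j) (fun i j => B i j) _) x = _
    rw [Fin.append_right]
    rfl
  simp only [Set.mem_inter_iff, Set.mem_ofPred_eq, Pi.le_def, Fin.forall_fin_add, hl, hr,
    Fin.append_left, Fin.append_right]

theorem IsPolyhedral.isPolyhedralUnion {P : Set (Fin n → ℝ)} (hP : IsPolyhedral P) :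
    IsPolyhedralUnion P :=
  ⟨{P}, by simpa using hP, by simp⟩

theorem IsPolyhedralUnion.inter {S T : Set (Fin n → ℝ)} (hS : IsPolyhedralUnion S)
    (hT : IsPolyhedralUnion T) : IsPolyhedralUnion (S ∩ T) := by
  classical
  obtain ⟨F, hF, rfl⟩ := hS
  obtain ⟨G, hG, rfl⟩ := hT
  refine ⟨(F ×ˢ G).image fun p => p.1 ∩ p.2, ?_, ?_⟩
  · intro P hP
    obtain ⟨p, hp, rfl⟩ := Finset.mem_image.1 hP
    rw [Finset.mem_product] at hp
    exact (hF _ hp.1).inter (hG _ hp.2)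
  · ext x
    simp only [Set.mem_inter_iff, Set.mem_iUnion, Finset.mem_image, Finset.mem_product,
      exists_prop]
    constructor
    · rintro ⟨⟨P, hP, hx⟩, Q, hQ, hx'⟩
      exact ⟨P ∩ Q, ⟨(P, Q), ⟨hP, hQ⟩, rfl⟩, hx, hx'⟩
    · rintro ⟨_, ⟨⟨P, Q⟩, ⟨hP, hQ⟩, rfl⟩, hx, hx'⟩
      exact ⟨⟨P, hP, hx⟩, Q, hQ, hx'⟩

theorem IsPolyhedralUnion.union {S T : Set (Fin n → ℝ)} (hS : IsPolyhedralUnion S)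
    (hT : IsPolyhedralUnion T) : IsPolyhedralUnion (S ∪ T) := by
  classical
  obtain ⟨F, hF, rfl⟩ := hS
  obtain ⟨G, hG, rfl⟩ := hT
  refine ⟨F ∪ G, fun P hP => (Finset.mem_union.1 hP).elim (hF P) (hG P), ?_⟩
  rw [Finset.set_biUnion_union]

theorem isPolyhedralUnion_biInter {ι : Type*} (s : Finset ι) (S : ι → Set (Fin n → ℝ))
    (h : ∀ i ∈ s, IsPolyhedralUnion (S i)) : IsPolyhedralUnion (⋂ i ∈ s, S i) := by
  classical
  induction s using Finset.induction_on with
  | empty => simpa using isPolyhedral_univ.isPolyhedralUnion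
  | insert a s ha ih =>
    rw [Finset.set_biInter_insert]
    exact (h a (Finset.mem_insert_self a s)).inter
      (ih fun i hi => h i (Finset.mem_insert_of_mem hi))

theorem isPolyhedralUnion_biUnion {ι : Type*} (s : Finset ι) (S : ι → Set (Fin n → ℝ))
    (h : ∀ i ∈ s, IsPolyhedralUnion (S i)) : IsPolyhedralUnion (⋃ i ∈ s, S i) := by
  classical
  induction s using Finset.induction_on with
  | empty => exact ⟨∅, by simp, by simp⟩
  | insert a s ha ih =>
    rw [Finset.set_biUnion_insert]
    exact (h a (Finset.mem_insert_self a s)).union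
      (ih fun i hi => h i (Finset.mem_insert_of_mem hi))

theorem isPolyhedral_realForm_le (ε : ℝ) (a b : ℝ × (Fin n → ℤ)) :
    IsPolyhedral {x : Fin n → ℝ | realForm (ε, x) a ≤ realForm (ε, x) b} := by
  refine ⟨1, Matrix.of fun _ i => (b.2 i : ℝ) - a.2 i, fun _ => ε * a.1 - ε * b.1, ?_⟩
  ext x
  simp only [Set.mem_ofPred_eq, realForm_apply, Pi.le_def, Matrix.mulVec, dotProduct,
    Matrix.of_apply, forall_const, sub_mul, Finset.sum_sub_distrib]
  constructor <;> intro h <;> linarith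

theorem isPolyhedralUnion_dominated (ε : ℝ) (f g : Laurent n) :
    IsPolyhedralUnion {x : Fin n → ℝ | Dominated (realForm (ε, x)) f g} := by
  have : {x : Fin n → ℝ | Dominated (realForm (ε, x)) f g} =
      ⋂ m ∈ f.coeff.support, ⋃ m' ∈ g.coeff.support,
        {x | realForm (ε, x) (term f m) ≤ realForm (ε, x) (term g m')} := by
    ext x
    simp only [Dominated, Set.mem_ofPred_eq, Set.mem_iInter, Set.mem_iUnion, exists_prop]
  rw [this]
  exact isPolyhedralUnion_biInter _ _ fun m _ => isPolyhedralUnion_biUnion _ _ fun m' _ =>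
    (isPolyhedral_realForm_le ε _ _).isPolyhedralUnion

theorem isPolyhedralUnion_formVariety {ε : ℝ} (hε : 0 ≤ ε) {C : RingCon (Laurent n)}
    (hC : IsFG C) : IsPolyhedralUnion (formVariety ε C) := by
  obtain ⟨T, rfl⟩ := hC
  have : formVariety ε (ringConGen fun a b => (a, b) ∈ T) =
      ⋂ p ∈ T, ({x | Dominated (realForm (ε, x)) p.1 p.2} ∩
        {x | Dominated (realForm (ε, x)) p.2 p.1}) := by
    ext x
    rw [show (fun a b : Laurent n => (a, b) ∈ T) = fun a b => (a, b) ∈ (T : Set _) from rfl,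
      mem_formVariety_ringConGen hε]
    simp only [Set.mem_iInter, Set.mem_inter_iff, Set.mem_ofPred_eq, Finset.mem_coe]
  rw [this]
  exact isPolyhedralUnion_biInter _ _ fun p _ =>
    (isPolyhedralUnion_dominated ε _ _).inter (isPolyhedralUnion_dominated ε _ _)

theorem IsPolyhedralUnion.exists_hasPolyhedralDim {S : Set (Fin n → ℝ)}
    (hS : IsPolyhedralUnion S) : ∃ d, HasPolyhedralDim S d := by
  obtain ⟨F, hF, h⟩ := hS
  exact ⟨_, F, hF, h, rfl⟩

theorem IsPolyhedral.convex {P : Set (Fin n → ℝ)} (hP : IsPolyhedral P) : Convex ℝ P := by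
  obtain ⟨l, A, b, rfl⟩ := hP
  exact (convex_Ici b).linear_preimage A.mulVecLin

theorem affineDim_of_nonempty {P : Set (Fin n → ℝ)} (hP : P.Nonempty) :
    affineDim P = ((Module.finrank ℝ (affineSpan ℝ P).direction : ℕ) : ℕ∞) := if_pos hP

/-- Affine functions of arbitrarily different orders of magnitude at points of `P` bound the
dimension of `P` from below. -/
theorem le_affineDim_add_one {s : ℕ} (P : Set (Fin n → ℝ)) (b : Fin s → (Fin n → ℝ) →ᵃ[ℝ] ℝ)
    (h : ∃ᶠ K : ℕ in atTop, ∃ x ∈ P, (∀ i, 0 < b i x) ∧ ∀ i j, i < j → K * b i x < b j x) :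
    ((s : ℕ∞) : WithBot ℕ∞) ≤ affineDim P + 1 := by
  obtain ⟨-, p, hp, -⟩ := h.exists
  rw [affineDim_of_nonempty ⟨p, hp⟩]
  set W := (affineSpan ℝ P).direction
  suffices hs : s ≤ Module.finrank ℝ W + 1 by exact_mod_cast hs
  -- On the affine span of P, an affine function is determined by its linear part on W and its value
  -- at p. Injectivity of Φ is the linear independence of the `b i` there.
  set Φ : (Fin s → ℝ) →ₗ[ℝ] (W →ₗ[ℝ] ℝ) × ℝ :=
    Fintype.linearCombination ℝ fun i => ((b i).linear.domRestrict W, b i p) with hΦ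
  have hinj : Function.Injective Φ := by
    rw [injective_iff_map_eq_zero]
    intro c hc
    have hval : ∀ x ∈ P, ∑ i, c i * b i x = 0 := by
      intro x hx
      have hxW : x - p ∈ W :=
        AffineSubspace.vsub_mem_direction (subset_affineSpan ℝ P hx) (subset_affineSpan ℝ P hp)
      rw [hΦ, Fintype.linearCombination_apply] at hc
      have h1 := congrArg Prod.snd hc
      have h2 := congrArg (fun z : (W →ₗ[ℝ] ℝ) × ℝ => z.1 ⟨x - p, hxW⟩) hc
      simp only [Prod.snd_sum, Prod.fst_sum, Prod.smul_snd, Prod.smul_fst, smul_eq_mul,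
        Prod.snd_zero, Prod.fst_zero, LinearMap.sum_apply, LinearMap.smul_apply,
        LinearMap.zero_apply, LinearMap.domRestrict_apply] at h1 h2
      have h3 : ∀ i, b i x = (b i).linear (x - p) + b i p := fun i => by
        have := (b i).map_vadd p (x - p)
        simpa using this
      simp only [h3, mul_add, Finset.sum_add_distrib, h1, h2, add_zero]
    by_contra hne
    -- The last nonzero coefficient belongs to the dominant function; for K beyond `(∑ |c i|) / |c
    -- j|` the remaining terms cannot cancel it.
    obtain ⟨j, hj, hmax⟩ : ∃ j, c j ≠ 0 ∧ ∀ i, j < i → c i = 0 := by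
      have hne' : (Finset.univ.filter fun i => c i ≠ 0).Nonempty := by
        obtain ⟨i, hi⟩ := Function.ne_iff.1 hne
        exact ⟨i, by simpa using hi⟩
      refine ⟨_, (Finset.mem_filter.1 (Finset.max'_mem _ hne')).2, fun i hi => ?_⟩
      by_contra hci
      exact absurd (Finset.le_max' _ i (by simpa using hci)) (not_le.2 hi)
    obtain ⟨K₀, hK₀⟩ := exists_nat_gt ((∑ i, |c i|) / |c j|)
    obtain ⟨K, hK, x, hx, hpos, hgrow⟩ := (frequently_atTop.1 h) K₀
    have hcj : 0 < |c j| := abs_pos.2 hj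
    have hK' : ∑ i, |c i| < K * |c j| := by
      rw [div_lt_iff₀ hcj] at hK₀
      have : (K₀ : ℝ) ≤ K := by exact_mod_cast hK
      nlinarith
    have h0 := hval x hx
    rw [← Finset.add_sum_erase _ _ (Finset.mem_univ j)] at h0
    have h1 : |c j| * b j x ≤ ∑ i ∈ Finset.univ.erase j, |c i| * b i x := by
      rw [← abs_of_pos (hpos j), ← abs_mul, eq_neg_of_add_eq_zero_left h0, abs_neg]
      refine (Finset.abs_sum_le_sum_abs _ _).trans (Finset.sum_le_sum fun i _ => ?_)
      rw [abs_mul, abs_of_pos (hpos i)]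
    have h2 : K * ∑ i ∈ Finset.univ.erase j, |c i| * b i x ≤ (∑ i, |c i|) * b j x := by
      rw [Finset.mul_sum, Finset.sum_mul]
      refine (Finset.sum_le_sum (g := fun i => |c i| * b j x) fun i hi => ?_).trans
        (Finset.sum_le_sum_of_subset_of_nonneg (Finset.erase_subset _ _) fun i _ _ =>
          mul_nonneg (abs_nonneg _) (hpos j).le)
      rcases lt_or_gt_of_ne (Finset.ne_of_mem_erase hi) with hij | hij
      · have := mul_le_mul_of_nonneg_left (hgrow i j hij).le (abs_nonneg (c i))
        calc (K : ℝ) * (|c i| * b i x) = |c i| * (K * b i x) := by ring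
          _ ≤ _ := this
      · simp [hmax i hij]
    have h3 := mul_lt_mul_of_pos_right hK' (hpos j)
    have h4 := mul_le_mul_of_nonneg_left h1 (Nat.cast_nonneg (α := ℝ) K)
    linarith
  have := LinearMap.finrank_le_finrank_of_injective hinj
  rwa [Module.finrank_fin_fun, Module.finrank_prod, Module.finrank_self,
    show Module.finrank ℝ (W →ₗ[ℝ] ℝ) = Module.finrank ℝ W from Subspace.dual_finrank_eq] at this

end Polyhedral

/-! ### The upper bound -/

section UpperBound

variable {n : ℕ}

/-- `realForm (ε, x) a` as an affine function of `x`. -/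
def realAffine (ε : ℝ) (a : ℝ × (Fin n → ℤ)) : (Fin n → ℝ) →ᵃ[ℝ] ℝ :=
  (∑ i, (a.2 i : ℝ) • (LinearMap.proj i : (Fin n → ℝ) →ₗ[ℝ] ℝ)).toAffineMap +
    AffineMap.const ℝ _ (ε * a.1)

theorem realAffine_apply (ε : ℝ) (a : ℝ × (Fin n → ℤ)) (x : Fin n → ℝ) :
    realAffine ε a x = realForm (ε, x) a := by
  simp [realAffine, realForm_apply, add_comm]

/-- Pigeonhole: with finitely many pieces, one of them contains suitable points for infinitely many
K. -/
theorem HasPolyhedralDim.le_add_one {S : Set (Fin n → ℝ)} {d : WithBot ℕ∞}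
    (hS : HasPolyhedralDim S d) {s : ℕ} (b : Fin s → (Fin n → ℝ) →ᵃ[ℝ] ℝ)
    (h : ∀ K : ℕ, ∃ x ∈ S, (∀ i, 0 < b i x) ∧ ∀ i j, i < j → K * b i x < b j x) :
    ((s : ℕ∞) : WithBot ℕ∞) ≤ d + 1 := by
  obtain ⟨F, -, rfl, rfl⟩ := hS
  obtain ⟨P, hP, hfreq⟩ : ∃ P ∈ F, ∃ᶠ K : ℕ in atTop,
      ∃ x ∈ P, (∀ i, 0 < b i x) ∧ ∀ i j, i < j → K * b i x < b j x := by
    by_contra hcon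
    have h1 : ∀ P ∈ F, ∀ᶠ K : ℕ in atTop,
        ¬ ∃ x ∈ P, (∀ i, 0 < b i x) ∧ ∀ i j, i < j → K * b i x < b j x :=
      fun P hP => not_frequently.1 fun hP' => hcon ⟨P, hP, hP'⟩
    obtain ⟨K, hK⟩ := ((eventually_all_finset F).2 h1).exists
    obtain ⟨x, hx, hb⟩ := h K
    obtain ⟨P, hP, hxP⟩ := Set.mem_iUnion₂.1 hx
    exact hK P hP ⟨x, hxP, hb⟩
  exact (le_affineDim_add_one P b hfreq).trans (add_le_add_left (Finset.le_sup hP) 1)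

/-- The monomial a_i becomes trivial at the step from E_i to E_{i+1}, where a_j with j > i is still
positive. Hence for E_0 no multiple of a_i reaches a_j. Each K asks for finitely many such signs
only, so a real point realizes them. -/
theorem exists_mem_formVariety_of_chain {C : RingCon (Laurent n)} (hC : IsFG C) {r : ℕ}
    (E : Fin (r + 1) → RingCon (Laurent n)) (hE : ∀ i, IsPrimeCongruence (E i))
    (hmono : StrictMono E) (hCE : C ≤ E 0) :
    ∃ ε : ℝ, (ε = 1 ∨ ε = 0) ∧ ∃ a : Fin r → ℝ × (Fin n → ℤ), ∀ K : ℕ,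
      ∃ x ∈ formVariety ε C, (∀ i, 0 < realForm (ε, x) (a i)) ∧
        ∀ i j, i < j → K * realForm (ε, x) (a i) < realForm (ε, x) (a j) := by
  classical
  obtain ⟨T, rfl⟩ := hC
  choose a ha ha' han using fun i : Fin r =>
    exists_mem_cone_of_lt (hE i.castSucc) (hE i.succ) (hmono (Fin.castSucc_lt_succ (i := i)))
  have hcone : ∀ {i j : Fin (r + 1)}, i ≤ j → cone (E i) ≤ cone (E j) :=
    fun h => cone_mono (hmono.monotone h)
  have hneg : ∀ i, -a i ∉ cone (E 0) := fun i h => han i (hcone (Fin.zero_le _) h)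
  have hgrow : ∀ (K : ℕ) (i j : Fin r), i < j → K • a i - a j ∉ cone (E 0) := by
    intro K i j hij h
    have hle : i.succ ≤ j.castSucc := Fin.succ_le_castSucc_iff.2 hij
    have h1 := (cone (E j.castSucc)).add_mem (hcone (Fin.zero_le _) h)
      ((cone (E j.castSucc)).nsmul_mem (hcone hle (ha' i)) K)
    rw [smul_neg, ← sub_eq_add_neg, sub_right_comm, sub_self, zero_sub] at h1
    exact han j h1
  -- If E_0 puts some negative real above 0, then every real is equivalent to 0, so the functional
  -- must ignore coefficients.
  obtain ⟨ε, hε1, hε⟩ : ∃ ε : ℝ, (ε = 1 ∨ ε = 0) ∧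
      ((ε = 1 ∧ ∀ r : ℝ, r < 0 → (r, 0) ∉ cone (E 0)) ∨
        (ε = 0 ∧ ∃ r : ℝ, r < 0 ∧ (r, 0) ∈ cone (E 0))) := by
    by_cases h : ∃ r : ℝ, r < 0 ∧ (r, 0) ∈ cone (E 0)
    · exact ⟨0, Or.inr rfl, Or.inr ⟨rfl, h⟩⟩
    · exact ⟨1, Or.inl rfl, Or.inl ⟨rfl, fun r hr hr' => h ⟨r, hr, hr'⟩⟩⟩
  have hε0 : 0 ≤ ε := by rcases hε1 with rfl | rfl <;> norm_num
  refine ⟨ε, hε1, a, fun K => ?_⟩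
  set diffs : Laurent n → Laurent n → Finset (ℝ × (Fin n → ℤ)) := fun f g =>
    (f.coeff.support ×ˢ g.coeff.support).image fun p => term g p.2 - term f p.1
  obtain ⟨x, hx⟩ := exists_realForm_nonneg_iff (cone (E 0)) (hE 0).cone_total
    (fun s hs => real_mem_cone (E 0) hs) hε
    ((Finset.univ.image fun i => -a i) ∪ (Finset.univ.image fun p : Fin r × Fin r =>
      K • a p.1 - a p.2) ∪ (T.biUnion fun p => diffs p.1 p.2 ∪ diffs p.2 p.1))
  have hdom : ∀ f g, diffs f g ⊆ (T.biUnion fun p => diffs p.1 p.2 ∪ diffs p.2 p.1) →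
      E 0 f g → Dominated (realForm (ε, x)) f g := by
    intro f g hsub hfg m hm
    obtain ⟨m', hm', h⟩ := (hE 0).exists_sub_mem_cone hfg hm
    refine ⟨m', hm', ?_⟩
    rw [hx _ (Finset.mem_union_right _ (hsub (Finset.mem_image.2
      ⟨(m, m'), Finset.mk_mem_product hm hm', rfl⟩))), map_sub, sub_nonneg] at h
    exact h
  refine ⟨x, ?_, fun i => ?_, fun i j hij => ?_⟩
  · refine (mem_formVariety_ringConGen hε0 (T : Set (Laurent n × Laurent n))).2 fun p hp => ?_
    have hp' : E 0 p.1 p.2 := hCE (RingCon.le_ringConGen p.1 p.2 hp)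
    refine ⟨hdom _ _ (fun z hz => ?_) hp', hdom _ _ (fun z hz => ?_) ((E 0).symm hp')⟩
    · exact Finset.mem_biUnion.2 ⟨p, hp, Finset.mem_union_left _ hz⟩
    · exact Finset.mem_biUnion.2 ⟨p, hp, Finset.mem_union_right _ hz⟩
  · have := hneg i
    rw [hx _ (Finset.mem_union_left _ (Finset.mem_union_left _ (Finset.mem_image_of_mem _
      (Finset.mem_univ i)))), map_neg, neg_nonneg, not_le] at this
    exact this
  · have := hgrow K i j hij
    rw [hx _ (Finset.mem_union_left _ (Finset.mem_union_right _ (Finset.mem_image.2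
      ⟨(i, j), Finset.mem_univ _, rfl⟩))), map_sub, map_nsmul, nsmul_eq_mul, sub_nonneg,
      not_le] at this
    exact this

theorem realForm_zero_smul (t : ℝ) (x : Fin n → ℝ) (a : ℝ × (Fin n → ℤ)) :
    realForm (0, t • x) a = t * realForm (0, x) a := by
  simp only [realForm_apply, zero_mul, zero_add, Finset.mul_sum, Pi.smul_apply, smul_eq_mul]
  exact Finset.sum_congr rfl fun i _ => by ring

theorem smul_mem_formVariety_zero {C : RingCon (Laurent n)} {x : Fin n → ℝ}
    (hx : x ∈ formVariety 0 C) {t : ℝ} (ht : 0 ≤ t) : t • x ∈ formVariety 0 C := by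
  intro f g hfg m hm
  obtain ⟨m', hm', h⟩ := hx f g hfg m hm
  refine ⟨m', hm', ?_⟩
  rw [realForm_zero_smul, realForm_zero_smul]
  exact mul_le_mul_of_nonneg_left h ht

theorem natCast_le_of_add_one_le {r : ℕ} {e : WithBot ℕ∞}
    (h : (((r + 1 : ℕ) : ℕ∞) : WithBot ℕ∞) ≤ e + 1) : ((r : ℕ∞) : WithBot ℕ∞) ≤ e := by
  induction e with
  | bot => exact absurd h (by simp)
  | coe e =>
    norm_cast at h ⊢
    push_cast at h
    exact (ENat.add_le_add_iff_right ENat.one_ne_top).1 h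

/-- For ε = 0 the functions are homogeneous on a cone. Scaling the point by a large t makes all of
them exceed K, so the constant 1 can be put in front as the smallest function. -/
theorem length_le_max {C : RingCon (Laurent n)} (hC : IsFG C) {d e : WithBot ℕ∞}
    (hd : HasPolyhedralDim (formVariety 1 C) d) (he : HasPolyhedralDim (formVariety 0 C) e) {r : ℕ}
    (E : Fin (r + 1) → RingCon (Laurent n)) (hE : ∀ i, IsPrimeCongruence (E i))
    (hmono : StrictMono E) (hCE : C ≤ E 0) :
    ((r : ℕ∞) : WithBot ℕ∞) ≤ max (d + 1) e := by
  obtain ⟨ε, rfl | rfl, a, ha⟩ := exists_mem_formVariety_of_chain hC E hE hmono hCE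
  · refine le_max_of_le_left (hd.le_add_one (fun i => realAffine 1 (a i)) fun K => ?_)
    simpa only [realAffine_apply] using ha K
  · refine le_max_of_le_right (natCast_le_of_add_one_le (he.le_add_one
      (Fin.cons (AffineMap.const ℝ _ 1) fun i => realAffine 0 (a i)) fun K => ?_))
    obtain ⟨x, hx, hpos, hgrow⟩ := ha K
    have hev : ∀ᶠ t : ℝ in atTop, ∀ i, (K : ℝ) < t * realForm (0, x) (a i) :=
      eventually_all.2 fun i =>
        (tendsto_id.atTop_mul_const (hpos i)).eventually_gt_atTop (K : ℝ)
    obtain ⟨t, ht, ht0⟩ := (hev.and (eventually_gt_atTop 0)).exists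
    refine ⟨t • x, smul_mem_formVariety_zero hx ht0.le, fun i => ?_, fun i j => ?_⟩
    · refine Fin.cases ?_ (fun i => ?_) i
      · simp
      · rw [Fin.cons_succ, realAffine_apply, realForm_zero_smul]
        exact mul_pos ht0 (hpos i)
    · refine Fin.cases ?_ (fun j => ?_) j
      · exact fun h => absurd h (Fin.not_lt_zero i)
      · refine Fin.cases (fun _ => ?_) (fun i hij => ?_) i
        · simpa [realAffine_apply, realForm_zero_smul] using ht j
        · rw [Fin.cons_succ, Fin.cons_succ, realAffine_apply, realForm_zero_smul, realAffine_apply,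
            realForm_zero_smul]
          have := mul_lt_mul_of_pos_left (hgrow i j (Fin.succ_lt_succ_iff.1 hij)) ht0
          linarith

theorem krullDim_quotient_le {C : RingCon (Laurent n)} (hC : IsFG C) {d e : WithBot ℕ∞}
    (hd : HasPolyhedralDim (formVariety 1 C) d) (he : HasPolyhedralDim (formVariety 0 C) e) :
    krullDim C.Quotient ≤ max (d + 1) e := by
  refine iSup_le fun p => ?_
  refine length_le_max hC hd he (fun i => (p i).1.comap C.mk') (fun i => (p i).2.comap_mk') ?_ ?_
  · intro i j hij
    have hlt : (p i).1 < (p j).1 := p.strictMono hij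
    exact lt_of_le_of_ne (RingCon.comap_mono hlt.le) fun h =>
      hlt.ne (RingCon.comap_injective C.mk' (RingCon.mk'_surjective C) h)
  · intro f g hfg
    have : C.mk' f = C.mk' g := (RingCon.eq C).2 hfg
    change (p 0).1 (C.mk' f) (C.mk' g)
    rw [this]
    exact (p 0).1.refl _

end UpperBound

open Topology

/-! ### Lexicographic prime congruences -/

section Lexicographic

variable {n k : ℕ}

/-- The lexicographic combination of the functionals `realForm (u i)`. -/
def lexForm (u : Fin k → ℝ × (Fin n → ℝ)) : ℝ × (Fin n → ℤ) →+ Lex (Fin k → ℝ) where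
  toFun a := toLex fun i => realForm (u i) a
  map_zero' := by
    simp only [map_zero]
    rfl
  map_add' a b := by
    simp only [map_add]
    rfl

theorem lexForm_apply (u : Fin k → ℝ × (Fin n → ℝ)) (a : ℝ × (Fin n → ℤ)) :
    lexForm u a = toLex fun i => realForm (u i) a := rfl

theorem lexForm_nonneg {u : Fin k → ℝ × (Fin n → ℝ)} (hu : ∀ i, 0 ≤ (u i).1) (r : ℝ)
    (hr : 0 ≤ r) : 0 ≤ lexForm u (r, 0) :=
  Pi.toLex_monotone (show (0 : Fin k → ℝ) ≤ fun i => realForm (u i) (r, 0) from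
    fun i => realForm_nonneg (u i) (hu i) r hr)

/-- The first `j` members of a family, followed by zeros. -/
def truncate {A : Type*} [Zero A] (j : ℕ) (u : Fin k → A) : Fin k → A :=
  fun i => if i.val < j then u i else 0

theorem toLex_truncate_mono (j : ℕ) {v w : Fin k → ℝ} (h : toLex v ≤ toLex w) :
    toLex (truncate j v) ≤ toLex (truncate j w) := by
  rcases h.eq_or_lt with h | ⟨i, hlt, hi⟩
  · rw [toLex_inj.1 h]
  · by_cases hij : i.val < j
    · refine le_of_lt ⟨i, fun l hl => ?_, ?_⟩
      · have : v l = w l := hlt l hl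
        change truncate j v l = truncate j w l
        simp only [truncate, this]
      · have hi' : v i < w i := hi
        change truncate j v i < truncate j w i
        simpa only [truncate, if_pos hij] using hi'
    · refine le_of_eq (congrArg toLex (funext fun l => ?_))
      by_cases hl : l.val < j
      · have : v l = w l := hlt l (Fin.lt_def.2 (by omega))
        simp only [truncate, this]
      · simp only [truncate, if_neg hl]

theorem realForm_zero (a : ℝ × (Fin n → ℤ)) : realForm 0 a = 0 := by
  simp [realForm_apply]

theorem lexForm_truncate (j : ℕ) (u : Fin k → ℝ × (Fin n → ℝ)) (a : ℝ × (Fin n → ℤ)) :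
    lexForm (truncate j u) a = toLex (truncate j fun i => realForm (u i) a) := by
  refine congrArg toLex (funext fun i => ?_)
  by_cases h : i.val < j
  · simp only [truncate, if_pos h]
  · simp only [truncate, if_neg h, realForm_zero]

theorem truncate_truncate {A : Type*} [Zero A] {i j : ℕ} (h : i ≤ j) (u : Fin k → A) :
    truncate i (truncate j u) = truncate i u := by
  funext l
  by_cases hl : l.val < i
  · simp only [truncate, if_pos hl, if_pos (hl.trans_le h)]
  · simp only [truncate, if_neg hl]

theorem truncate_self {A : Type*} [Zero A] (u : Fin k → A) : truncate k u = u :=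
  funext fun l => if_pos l.isLt

theorem truncate_fst_nonneg {u : Fin k → ℝ × (Fin n → ℝ)} (hu : ∀ i, 0 ≤ (u i).1) (j : ℕ)
    (i : Fin k) : 0 ≤ (truncate j u i).1 := by
  by_cases h : i.val < j
  · simpa only [truncate, if_pos h] using hu i
  · simp only [truncate, if_neg h, Prod.fst_zero, le_refl]

/-- Evaluation with respect to the first `j` functionals of a lexicographic family. -/
def lexEval {u : Fin k → ℝ × (Fin n → ℝ)} (hu : ∀ i, 0 ≤ (u i).1) (j : ℕ) :
    Laurent n →+* Tropical (WithTop (Lex (Fin k → ℝ))ᵒᵈ) :=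
  evalHom (lexForm (truncate j u)) (lexForm_nonneg (truncate_fst_nonneg hu j))

/-- Forgetting trailing coordinates is monotone for the lexicographic order; padding with zeros
keeps all evaluations in one ordered group. -/
theorem ker_lexEval_antitone {u : Fin k → ℝ × (Fin n → ℝ)} (hu : ∀ i, 0 ≤ (u i).1) {i j : ℕ}
    (h : i ≤ j) : RingCon.ker (lexEval hu j) ≤ RingCon.ker (lexEval hu i) := by
  have key : ∀ f g, Dominated (lexForm (truncate j u)) f g →
      Dominated (lexForm (truncate i u)) f g := by
    intro f g hfg m hm
    obtain ⟨m', hm', hle⟩ := hfg m hm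
    refine ⟨m', hm', ?_⟩
    rw [← truncate_truncate h, lexForm_truncate, lexForm_truncate]
    exact toLex_truncate_mono i hle
  intro f g hfg
  rw [lexEval, ker_evalHom_iff] at hfg ⊢
  exact ⟨key _ _ hfg.1, key _ _ hfg.2⟩

/-- As t tends to 0 from above, the first nonzero coefficient decides the sign. -/
theorem eventually_sum_pow_neg {v : Fin k → ℝ} (hv : toLex v < 0) :
    ∀ᶠ t : ℝ in 𝓝[>] 0, ∑ i, t ^ i.val * v i < 0 := by
  obtain ⟨i, h0, hi⟩ := hv
  have h0' : ∀ j, j < i → v j = 0 := h0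
  have hi' : v i < 0 := hi
  -- The sum divided by t^i, extended continuously to t = 0. Terms with j < i vanish and are left
  -- out, since the natural subtraction would truncate there.
  set g : ℝ → ℝ := fun t => ∑ j, if j < i then 0 else t ^ (j.val - i.val) * v j with hg
  have hcont : Continuous g := by
    refine continuous_finsetSum _ fun j _ => ?_
    by_cases h : j < i
    · simp only [if_pos h]; exact continuous_const
    · simp only [if_neg h]; fun_prop
  have hg0 : g 0 = v i := by
    rw [hg]
    refine (Finset.sum_eq_single i (fun j _ hj => ?_) (by simp)).trans (by simp)
    by_cases h : j < i
    · exact if_pos h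
    · have hlt : i < j := lt_of_le_of_ne (not_lt.1 h) hj.symm
      rw [if_neg h, zero_pow (Nat.sub_ne_zero_of_lt hlt), zero_mul]
  have hev : ∀ᶠ t in 𝓝 (0 : ℝ), g t < 0 :=
    hcont.continuousAt.eventually_lt continuousAt_const (by rwa [hg0])
  filter_upwards [nhdsWithin_le_nhds hev, self_mem_nhdsWithin] with t ht htpos
  have heq : ∑ j, t ^ j.val * v j = t ^ i.val * g t := by
    rw [hg, Finset.mul_sum]
    refine Finset.sum_congr rfl fun j _ => ?_
    by_cases h : j < i
    · rw [if_pos h, h0' j h, mul_zero, mul_zero]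
    · rw [if_neg h, ← mul_assoc, ← pow_add, Nat.add_sub_cancel' (not_lt.1 h)]
  rw [heq]
  exact mul_neg_of_pos_of_neg (pow_pos htpos _) ht

theorem realForm_sum_smul (c : Fin k → ℝ) (u : Fin k → ℝ × (Fin n → ℝ))
    (a : ℝ × (Fin n → ℤ)) : realForm (∑ i, c i • u i) a = ∑ i, c i * realForm (u i) a := by
  simp only [realForm_apply, Prod.fst_sum, Prod.snd_sum, Prod.smul_fst, Prod.smul_snd,
    Finset.sum_apply, Pi.smul_apply, smul_eq_mul, mul_add, Finset.sum_add_distrib,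
    Finset.mul_sum, Finset.sum_mul]
  rw [Finset.sum_comm (γ := Fin n)]
  congr 1
  · exact Finset.sum_congr rfl fun i _ => by ring
  · exact Finset.sum_congr rfl fun i _ => Finset.sum_congr rfl fun j _ => by ring

/-- A term of f lexicographically above every term of g would be strictly above them at curve points
with small t, which lie in the variety. -/
theorem le_ker_lexEval {C : RingCon (Laurent n)} {ε : ℝ} {u : Fin k → ℝ × (Fin n → ℝ)}
    (hu : ∀ i, 0 ≤ (u i).1)
    (hcurve : ∀ᶠ t : ℝ in 𝓝[>] 0, ∃ y ∈ formVariety ε C, ∑ i, t ^ i.val • u i = (ε, y)) :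
    C ≤ RingCon.ker (lexEval hu k) := by
  have key : ∀ f g, C f g → Dominated (lexForm (truncate k u)) f g := by
    intro f g hfg m hm
    rw [truncate_self]
    by_contra! hcon
    have h1 : ∀ m' ∈ g.coeff.support, ∀ᶠ t : ℝ in 𝓝[>] 0,
        ∑ i, t ^ i.val * realForm (u i) (term g m' - term f m) < 0 := by
      intro m' hm'
      refine eventually_sum_pow_neg ?_
      rw [← lexForm_apply, map_sub, sub_neg]
      exact hcon m' hm'
    obtain ⟨t, ht, y, hy, hyt⟩ := (((eventually_all_finset _).2 h1).and hcurve).exists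
    obtain ⟨m', hm', hle⟩ := hy f g hfg m hm
    have h2 := ht m' hm'
    rw [← realForm_sum_smul, hyt, map_sub] at h2
    linarith
  intro f g hfg
  rw [lexEval, ker_evalHom_iff]
  exact ⟨key f g hfg, key g f (C.symm hfg)⟩

theorem ker_lexEval_monomial_one {u : Fin k → ℝ × (Fin n → ℝ)} (hu : ∀ i, 0 ≤ (u i).1) (j : ℕ)
    (a : ℝ × (Fin n → ℤ)) :
    RingCon.ker (lexEval hu j) (monomial a) 1 ↔ ∀ i : Fin k, i.val < j → realForm (u i) a = 0 := by
  rw [RingCon.ker_apply, map_one, lexEval, evalHom_monomial, ← ofGroup_zero,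
    ofGroup_injective.eq_iff, lexForm_truncate]
  constructor
  · intro h i hi
    have := congrFun (congrArg ofLex h) i
    change truncate j (fun i => realForm (u i) a) i = 0 at this
    rwa [truncate, if_pos hi] at this
  · intro h
    refine congrArg toLex (funext fun i => ?_)
    by_cases hi : i.val < j
    · simp only [truncate, if_pos hi, h i hi]
    · simp only [truncate, if_neg hi]

/-- The monomial `a i` is killed by the functionals before `u i` but not by `u i`, so each
truncation enlarges the kernel. The empty truncation still gives a prime, whence k + 1 primes. -/
theorem le_krullDim_quotient {C : RingCon (Laurent n)} {ε : ℝ} {u : Fin k → ℝ × (Fin n → ℝ)}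
    (hu : ∀ i, 0 ≤ (u i).1)
    (hcurve : ∀ᶠ t : ℝ in 𝓝[>] 0, ∃ y ∈ formVariety ε C, ∑ i, t ^ i.val • u i = (ε, y))
    (a : Fin k → ℝ × (Fin n → ℤ)) (ha : ∀ i, realForm (u i) (a i) ≠ 0)
    (ha' : ∀ i j, j < i → realForm (u j) (a i) = 0) :
    ((k : ℕ∞) : WithBot ℕ∞) ≤ krullDim C.Quotient := by
  have hC := le_ker_lexEval hu hcurve
  have hCj : ∀ i : Fin (k + 1), C ≤ RingCon.ker (lexEval hu (k - i.val)) := fun i =>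
    hC.trans (ker_lexEval_antitone hu (Nat.sub_le _ _))
  refine Order.le_krullDim_iff.2 ⟨LTSeries.mk k
    (fun i => ⟨RingCon.ker (C.lift (lexEval hu (k - i.val)) (hCj i)),
      isPrimeCongruence_ker _⟩) ?_, rfl⟩
  rw [Fin.strictMono_iff_lt_succ]
  intro i
  have hi := i.isLt
  change RingCon.ker _ < RingCon.ker _
  refine lt_of_le_not_ge (fun x y hxy => ?_) fun hle => ?_
  · obtain ⟨f, rfl⟩ := RingCon.mk'_surjective C x
    obtain ⟨g, rfl⟩ := RingCon.mk'_surjective C y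
    rw [RingCon.ker_apply, RingCon.lift_mk', RingCon.lift_mk'] at hxy ⊢
    exact ker_lexEval_antitone hu (Nat.sub_le_sub_left (by simp) k) hxy
  · set l : Fin k := ⟨k - (i.val + 1), by omega⟩ with hl
    have h1 : RingCon.ker (lexEval hu (k - i.succ.val)) (monomial (a l)) 1 := by
      rw [ker_lexEval_monomial_one]
      exact fun j hj => ha' l j (Fin.lt_def.2 (by simpa [hl] using hj))
    have h2 : RingCon.ker (lexEval hu (k - i.castSucc.val)) (monomial (a l)) 1 := by
      have := @hle (C.mk' (monomial (a l))) (C.mk' 1) (by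
        rw [RingCon.ker_apply, RingCon.lift_mk', RingCon.lift_mk']
        exact h1)
      rwa [RingCon.ker_apply, RingCon.lift_mk', RingCon.lift_mk'] at this
    rw [ker_lexEval_monomial_one] at h2
    refine ha l (h2 l ?_)
    simp only [hl, Fin.val_castSucc]
    omega

end Lexicographic

/-! ### The lower bounds -/

section LowerBound

variable {n : ℕ}

theorem exists_relative_ball {P : Set (Fin n → ℝ)} (hP : Convex ℝ P) (hne : P.Nonempty) :
    ∃ x ∈ P, ∃ η > 0, ∀ w ∈ (affineSpan ℝ P).direction, ‖w‖ < η → x + w ∈ P := by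
  obtain ⟨x, hx⟩ := hne.intrinsicInterior hP
  obtain ⟨y, hy, rfl⟩ := mem_intrinsicInterior.1 hx
  obtain ⟨η, hη, hball⟩ := Metric.isOpen_iff.1 isOpen_interior y hy
  refine ⟨y, intrinsicInterior_subset hx, η, hη, fun w hw hwη => ?_⟩
  have hmem : (y : Fin n → ℝ) + w ∈ affineSpan ℝ P := by
    rw [add_comm]
    exact AffineSubspace.vadd_mem_of_mem_direction hw y.2
  have : (⟨y + w, hmem⟩ : affineSpan ℝ P) ∈ Metric.ball y η := by
    rw [Metric.mem_ball, Subtype.dist_eq, dist_eq_norm]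
    simpa using hwη
  exact interior_subset (s := ((↑) : affineSpan ℝ P → Fin n → ℝ) ⁻¹' P) (hball this)

/-- A subspace of `ℝⁿ` has a basis dual to some of the coordinate functions. -/
theorem exists_dual_coordinates (W : Submodule ℝ (Fin n → ℝ)) :
    ∃ (J : Fin (Module.finrank ℝ W) → Fin n) (w : Fin (Module.finrank ℝ W) → Fin n → ℝ),
      (∀ i, w i ∈ W) ∧ ∀ i j, w i (J j) = if i = j then 1 else 0 := by
  set v : Fin n → (W →ₗ[ℝ] ℝ) := fun i => (LinearMap.proj i).domRestrict W with hv
  -- The coordinate functions separate the points of W, so a maximal independent subfamily of their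
  -- restrictions is a basis of its dual; the `w i` form the dual basis.
  obtain ⟨κ, J, hJ, hspan, hli⟩ := exists_linearIndependent' ℝ v
  have : Finite κ := Finite.of_injective J hJ
  have := Fintype.ofFinite κ
  set Ψ : W →ₗ[ℝ] (κ → ℝ) := LinearMap.pi fun k => v (J k) with hΨ
  have hinj : Function.Injective Ψ := by
    rw [injective_iff_map_eq_zero]
    intro x hx
    have h1 : Submodule.span ℝ (Set.range (v ∘ J)) ≤
        LinearMap.ker (LinearMap.applyₗ (R := ℝ) (M₂ := ℝ) x) := by
      rw [Submodule.span_le]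
      rintro _ ⟨k, rfl⟩
      exact congrFun hx k
    rw [hspan] at h1
    refine Subtype.ext (funext fun i => ?_)
    exact h1 (Submodule.subset_span ⟨i, rfl⟩)
  have hcard : Module.finrank ℝ W = Fintype.card κ := by
    apply le_antisymm
    · simpa using LinearMap.finrank_le_finrank_of_injective hinj
    · rw [← show Module.finrank ℝ (W →ₗ[ℝ] ℝ) = Module.finrank ℝ W from Subspace.dual_finrank_eq]
      exact hli.fintype_card_le_finrank
  have hsurj : Function.Surjective Ψ :=
    (LinearMap.injective_iff_surjective_of_finrank_eq_finrank (by simpa using hcard)).1 hinj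
  classical
  choose w hw using fun k : κ => hsurj (Pi.single k 1)
  set e : Fin (Module.finrank ℝ W) ≃ κ := (Fintype.equivFinOfCardEq hcard.symm).symm
  refine ⟨J ∘ e, fun i => w (e i), fun i => (w (e i)).2, fun i j => ?_⟩
  have : Ψ (w (e i)) (e j) = (Pi.single (e i) 1 : κ → ℝ) (e j) := by rw [hw]
  rw [Pi.single_apply] at this
  simpa [hΨ, hv, eq_comm] using this

theorem eventually_add_mem {P : Set (Fin n → ℝ)} {W : Submodule ℝ (Fin n → ℝ)} {x : Fin n → ℝ}
    {η : ℝ} (hη : 0 < η) (h : ∀ w ∈ W, ‖w‖ < η → x + w ∈ P) {k : ℕ} (w : Fin k → Fin n → ℝ)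
    (hw : ∀ i, w i ∈ W) : ∀ᶠ t : ℝ in 𝓝[>] 0, x + ∑ i, t ^ (i.val + 1) • w i ∈ P := by
  have hcont : Continuous fun t : ℝ => ‖∑ i, t ^ (i.val + 1) • w i‖ := by fun_prop
  have hev : ∀ᶠ t in 𝓝 (0 : ℝ), ‖∑ i, t ^ (i.val + 1) • w i‖ < η :=
    hcont.continuousAt.eventually_lt continuousAt_const (by simpa using hη)
  filter_upwards [nhdsWithin_le_nhds hev] with t ht
  exact h _ (W.sum_mem fun i _ => W.smul_mem _ (hw i)) ht

theorem realForm_single (u : ℝ × (Fin n → ℝ)) (r : ℝ) (z : ℤ) (j : Fin n) :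
    realForm u (r, Pi.single j z) = u.1 * r + z * u.2 j := by
  rw [realForm_apply, Finset.sum_eq_single j (fun i _ hi => by simp [hi]) (by simp)]
  simp

theorem affineDim_add_one_le_krullDim {C : RingCon (Laurent n)} {P : Set (Fin n → ℝ)}
    (hP : Convex ℝ P) (hPC : P ⊆ formVariety 1 C) : affineDim P + 1 ≤ krullDim C.Quotient := by
  by_cases hne : P.Nonempty
  swap
  · rw [affineDim, if_neg hne]
    exact bot_le
  rw [affineDim_of_nonempty hne]
  obtain ⟨x, -, η, hη, hx⟩ := exists_relative_ball hP hne
  obtain ⟨J, w, hw, hJ⟩ := exists_dual_coordinates (affineSpan ℝ P).direction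
  revert J w
  generalize Module.finrank ℝ (affineSpan ℝ P).direction = d
  intro J w hw hJ
  have := le_krullDim_quotient (C := C) (ε := 1)
    (u := (Fin.cons (1, x) fun i => (0, w i) : Fin (d + 1) → ℝ × (Fin n → ℝ)))
    (fun i => by refine Fin.cases ?_ (fun i => ?_) i <;> simp) (by
      filter_upwards [eventually_add_mem hη hx w hw] with t ht
      refine ⟨_, hPC ht, ?_⟩
      simp [Fin.sum_univ_succ, Prod.ext_iff, Prod.fst_sum, Prod.snd_sum])
    -- The coefficient `-x (J i)` makes the functional (1, x) vanish on the monomial in the variable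
    -- `J i`.
    (Fin.cons (1, 0) fun i => (-x (J i), Pi.single (J i) 1))
    (fun i => by
      refine Fin.cases ?_ (fun i => ?_) i
      · simp [realForm_apply]
      · rw [Fin.cons_succ, Fin.cons_succ, realForm_single]
        simp [hJ])
    (fun i j => by
      refine Fin.cases (fun h => absurd h (Fin.not_lt_zero j)) (fun i => ?_) i
      refine Fin.cases (fun _ => ?_) (fun j hij => ?_) j
      · rw [Fin.cons_succ, Fin.cons_zero, realForm_single]
        simp
      · have : j ≠ i := ne_of_lt (Fin.succ_lt_succ_iff.1 hij)
        rw [Fin.cons_succ, Fin.cons_succ, realForm_single]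
        simp [hJ, this])
  exact_mod_cast this

theorem exists_rat_near (r : ℝ) {ρ : ℝ} (hρ : 0 < ρ) : ∃ q : ℚ, q ≠ 0 ∧ |(q : ℝ) - r| < ρ := by
  -- Two candidates are taken, since the first may be 0.
  obtain ⟨q₁, h1, h2⟩ := exists_rat_btwn (show r < r + ρ by linarith)
  obtain ⟨q₂, h3, h4⟩ := exists_rat_btwn h2
  by_cases h : q₁ = 0
  · refine ⟨q₂, fun h' => ?_, ?_⟩
    · rw [h, h'] at h3
      exact lt_irrefl _ h3
    · rw [abs_of_pos (by linarith)]
      linarith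
  · refine ⟨q₁, h, ?_⟩
    rw [abs_of_pos (by linarith)]
    linarith

/-- Coefficients cannot correct the value at the base point here, so that point is moved to one with
rational coordinates at the `J j`. It takes the place of `w 0` in the family, which therefore has as
many members as the dimension. -/
theorem affineDim_le_krullDim {C : RingCon (Laurent n)} {P : Set (Fin n → ℝ)}
    (hP : Convex ℝ P) (hPC : P ⊆ formVariety 0 C) : affineDim P ≤ krullDim C.Quotient := by
  by_cases hne : P.Nonempty
  swap
  · rw [affineDim, if_neg hne]
    exact bot_le
  rw [affineDim_of_nonempty hne]
  obtain ⟨x, hxP, η, hη, hx⟩ := exists_relative_ball hP hne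
  obtain ⟨J, w, hw, hJ⟩ := exists_dual_coordinates (affineSpan ℝ P).direction
  revert J w
  generalize Module.finrank ℝ (affineSpan ℝ P).direction = d
  intro J w hw hJ
  cases d with
  | zero =>
    -- In dimension 0 one prime suffices: the empty family, with the origin as the constant curve.
    refine le_krullDim_quotient (C := C) (ε := 0) (k := 0) (u := fun i => i.elim0)
      (fun i => i.elim0) (Eventually.of_forall fun t => ⟨0, ?_, by simp; rfl⟩) (fun i => i.elim0)
      (fun i => i.elim0) (fun i => i.elim0)
    simpa using smul_mem_formVariety_zero (hPC hxP) (le_refl 0)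
  | succ d =>
    obtain ⟨ρ, hρ, hball⟩ : ∃ ρ > 0, ∀ δ : Fin (d + 1) → ℝ, ‖δ‖ < ρ → ‖∑ i, δ i • w i‖ < η / 2 := by
      have hcont : Continuous fun δ : Fin (d + 1) → ℝ => ‖∑ i, δ i • w i‖ := by fun_prop
      have hev : ∀ᶠ δ in 𝓝 (0 : Fin (d + 1) → ℝ), ‖∑ i, δ i • w i‖ < η / 2 :=
        hcont.continuousAt.eventually_lt continuousAt_const (by simpa using hη)
      obtain ⟨ρ, hρ, h⟩ := Metric.eventually_nhds_iff.1 hev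
      exact ⟨ρ, hρ, fun δ hδ => h (by simpa using hδ)⟩
    choose q hq0 hq using fun i => exists_rat_near (x (J i)) hρ
    -- By duality this shift changes the coordinate `J j` from `x (J j)` to `q j`. It uses less than
    -- half of the radius η and leaves the rest for the curve.
    set y := x + ∑ i, ((q i : ℝ) - x (J i)) • w i with hy
    have hyJ : ∀ j, y (J j) = q j := by
      intro j
      simp [hy, Finset.sum_apply, hJ]
    have hyP : ∀ v ∈ (affineSpan ℝ P).direction, ‖v‖ < η / 2 → y + v ∈ P := by
      intro v hv hvη
      rw [hy, add_assoc]
      refine hx _ (Submodule.add_mem _ (Submodule.sum_mem _ fun i _ =>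
        Submodule.smul_mem _ _ (hw i)) hv) ?_
      have h1 := hball (fun i => (q i : ℝ) - x (J i)) ((pi_norm_lt_iff hρ).2 hq)
      exact (norm_add_le _ _).trans_lt (by linarith)
    -- Cleared denominators: `A i * q i.succ = B i * q 0`, so the integer exponent vector with
    -- entries A at `J i.succ` and -B at `J 0` is killed by y. Since `q 0 ≠ 0`, A is nonzero and `w
    -- i.succ` detects it.
    set A : Fin d → ℤ := fun i => (q 0).num * (q i.succ).den with hA
    set B : Fin d → ℤ := fun i => (q i.succ).num * (q 0).den with hB
    have hA0 : ∀ i, (A i : ℝ) ≠ 0 := fun i => by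
      have h1 : (q 0).num ≠ 0 := Rat.num_ne_zero.2 (hq0 0)
      have h2 : (q i.succ).den ≠ 0 := (q i.succ).den_nz
      exact_mod_cast mul_ne_zero h1 (Int.natCast_ne_zero.2 h2)
    have hAB : ∀ i, (A i : ℝ) * q i.succ - B i * q 0 = 0 := by
      intro i
      have h1 : ((q 0).num : ℚ) = q 0 * (q 0).den := (Rat.mul_den_eq_num _).symm
      have h2 : ((q i.succ).num : ℚ) = q i.succ * (q i.succ).den := (Rat.mul_den_eq_num _).symm
      have : (A i : ℚ) * q i.succ - B i * q 0 = 0 := by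
        simp only [hA, hB, Int.cast_mul, Int.cast_natCast, h1, h2]
        ring
      exact_mod_cast this
    have hform : ∀ (v : Fin n → ℝ) (i : Fin d),
        realForm (0, v) (0, Pi.single (J i.succ) (A i) - Pi.single (J 0) (B i)) =
          A i * v (J i.succ) - B i * v (J 0) := by
      intro v i
      have : ((0, Pi.single (J i.succ) (A i) - Pi.single (J 0) (B i)) : ℝ × (Fin n → ℤ)) =
          (0, Pi.single (J i.succ) (A i)) - (0, Pi.single (J 0) (B i)) := by simp
      rw [this, map_sub, realForm_single, realForm_single]
      simp
    refine le_krullDim_quotient (C := C) (ε := 0)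
      (u := (Fin.cons (0, y) fun i => (0, w i.succ) : Fin (d + 1) → ℝ × (Fin n → ℝ)))
      (fun i => by refine Fin.cases ?_ (fun i => ?_) i <;> simp) (by
        filter_upwards [eventually_add_mem (half_pos hη) hyP (fun i : Fin d => w i.succ)
          (fun i => hw _)] with t ht
        refine ⟨_, hPC ht, ?_⟩
        simp [Fin.sum_univ_succ, Prod.ext_iff, Prod.fst_sum, Prod.snd_sum])
      (Fin.cons (0, Pi.single (J 0) 1) fun i =>
        (0, Pi.single (J i.succ) (A i) - Pi.single (J 0) (B i)))
      (fun i => ?_) (fun i j => ?_)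
    · refine Fin.cases ?_ (fun i => ?_) i
      · rw [Fin.cons_zero, Fin.cons_zero, realForm_single]
        simpa [hyJ] using hq0 0
      · rw [Fin.cons_succ, Fin.cons_succ, hform, hJ, hJ, if_pos rfl, if_neg (Fin.succ_ne_zero i)]
        simpa using hA0 i
    · refine Fin.cases (fun h => absurd h (Fin.not_lt_zero j)) (fun i => ?_) i
      refine Fin.cases (fun _ => ?_) (fun j hij => ?_) j
      · rw [Fin.cons_succ, Fin.cons_zero, hform, hyJ, hyJ, hAB]
      · have : j.succ ≠ i.succ := ne_of_lt hij
        rw [Fin.cons_succ, Fin.cons_succ, hform, hJ, hJ, if_neg this,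
          if_neg (Fin.succ_ne_zero j)]
        simp

theorem HasPolyhedralDim.add_one_le_krullDim {C : RingCon (Laurent n)} {d : WithBot ℕ∞}
    (hd : HasPolyhedralDim (formVariety 1 C) d) : d + 1 ≤ krullDim C.Quotient := by
  obtain ⟨F, hF, hS, rfl⟩ := hd
  rcases F.eq_empty_or_nonempty with rfl | hne
  · exact bot_le
  · obtain ⟨P, hP, h⟩ := Finset.exists_mem_eq_sup F hne affineDim
    rw [h]
    refine affineDim_add_one_le_krullDim (hF P hP).convex ?_
    rw [hS]
    exact Set.subset_biUnion_of_mem (u := fun P => P) hP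

theorem HasPolyhedralDim.le_krullDim {C : RingCon (Laurent n)} {e : WithBot ℕ∞}
    (he : HasPolyhedralDim (formVariety 0 C) e) : e ≤ krullDim C.Quotient := by
  obtain ⟨F, hF, hS, rfl⟩ := he
  refine Finset.sup_le fun P hP => affineDim_le_krullDim (hF P hP).convex ?_
  rw [hS]
  exact Set.subset_biUnion_of_mem (u := fun P => P) hP

end LowerBound

end TropicalKrull

end

open TropicalKrull in
theorem corollary3p13 (n : ℕ) (C : RingCon (Laurent n)) (hproper : IsProper C) (hfg : IsFG C) :
    (∃ d : WithBot ℕ∞, HasPolyhedralDim (variety C) d) ∧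
    (∃ e : WithBot ℕ∞, HasPolyhedralDim (variety (booleCongruence C)) e) ∧
    ∀ d e : WithBot ℕ∞, HasPolyhedralDim (variety C) d →
      HasPolyhedralDim (variety (booleCongruence C)) e →
        krullDim C.Quotient = max (d + 1) e := by
  rw [variety_eq_formVariety, variety_booleCongruence]
  exact ⟨(isPolyhedralUnion_formVariety zero_le_one hfg).exists_hasPolyhedralDim,
    (isPolyhedralUnion_formVariety le_rfl hfg).exists_hasPolyhedralDim,
    fun d e hd he => le_antisymm (krullDim_quotient_le hfg hd he)
      (max_le hd.add_one_le_krullDim he.le_krullDim)⟩
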